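/- Let an oriented matroid $\mathcal M=(E,\mathcal C)$ on a finite ground set $E$ be given by its set $\mathcal C\subseteq\{+,-,0\}^E$ of signed circuits, and let its rank be the size of a largest subset of $E$ containing no circuit. For $k\ge 0$, call $\mathcal M$ $k$-neighborly if every circuit has more than $k$ positive and more than $k$ negative elements. For $R\subseteq E$ let ${}_{-R}\mathcal M$ be obtained from $\mathcal M$ by reversing the signs of the elements of $R$ in all circuits. If $\mathcal M$ has rank $r$ and $n$ elements, let $f_{\mathcal M}(r,n,k)$ be the number of subsets $R\subseteq E$ such that ${}_{-R}\mathcal M$ is $k$-neighborly. The alternating oriented matroid $C_r(n)$ on $[n]=\{1,\dots,n\}$ is the one whose circuits are all sign vectors with support $\{i_1<\dots<i_{r+1}\}$ of size $r+1$ whose signs alternate along $i_1<\dots<i_{r+1}$; put $c_r(n,k)=f_{C_r(n)}(r,n,k)$. A Lawrence oriented matroid (LOM) of rank $r$ on $[n]$ is a rank $r$ oriented matroid on $[n]$ for which there is an $r\times n$ matrix $A=(a_{i,j})$ with entries in $\{+1,-1\}$ such that a chirotope (basis orientation) $\chi$ of it satisfies $\chi(j_1,\dots,j_r)=\prod_{i=1}^r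 a_{i,j_i}$ for all $1\le j_1<\dots<j_r\le n$. Proposition. Let $k\ge 0$ and $r\ge 0$ be integers. Suppose that for every integer $r'$ with $2k+1\le r'\le r$ and every LOM $\mathcal M'$ of rank $r'$ on $n'=2(r'-k)+1$ elements, $$f_{\mathcal M'}(r',n',k)\le c_{r'}(n',k).$$ Then for every $n\ge 2(r-k)+1$ and every LOM $\mathcal M$ of rank $r$ on $n$ elements, $$f_{\mathcal M}(r,n,k)\le c_r(n,k).$$ -/

import Mathlib

/-- The positive elements `X⁺` of a sign vector `X`. -/
def signPos {E : Type*} [Fintype E] [DecidableEq E] (X : E → SignType) : Finset E :=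
  Finset.univ.filter fun e => X e = 1

/-- The negative elements `X⁻` of a sign vector `X`. -/
def signNeg {E : Type*} [Fintype E] [DecidableEq E] (X : E → SignType) : Finset E :=
  Finset.univ.filter fun e => X e = -1

/-- The support of a sign vector. -/
def signSupport {E : Type*} [Fintype E] [DecidableEq E] (X : E → SignType) : Finset E :=
  Finset.univ.filter fun e => X e ≠ 0

/-- An oriented matroid on a finite ground set `E`, given by its signed circuits: the empty sign
vector is not a circuit, circuits are closed under negation, two circuits with comparable supports
agree up to sign, and (weak) signed circuit elimination holds. -/
structure OrientedMatroid (E : Type*) [Fintype E] [DecidableEq E] where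
  circuits : Set (E → SignType)
  zero_notMem : (fun _ => 0) ∉ circuits
  neg_mem : ∀ X ∈ circuits, (fun e => -X e) ∈ circuits
  incomparable : ∀ X ∈ circuits, ∀ Y ∈ circuits, signSupport X ⊆ signSupport Y →
    X = Y ∨ X = fun e => -Y e
  elimination : ∀ X ∈ circuits, ∀ Y ∈ circuits, (X ≠ fun e => -Y e) →
    ∀ e ∈ signPos X ∩ signNeg Y, ∃ Z ∈ circuits,
      signPos Z ⊆ (signPos X ∪ signPos Y).erase e ∧
      signNeg Z ⊆ (signNeg X ∪ signNeg Y).erase e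

/-- The sign vector obtained from `X` by reversing the signs of the elements of `R`. -/
def reorientSign {E : Type*} [DecidableEq E] (R : Finset E) (X : E → SignType) : E → SignType :=
  fun e => if e ∈ R then -X e else X e

theorem reorientSign_reorientSign {E : Type*} [DecidableEq E] (R : Finset E) (X : E → SignType) :
    reorientSign R (reorientSign R X) = X := by
  funext e
  by_cases h : e ∈ R <;> simp [reorientSign, h]

theorem reorientSign_neg {E : Type*} [DecidableEq E] (R : Finset E) (X : E → SignType) :
    reorientSign R (fun e => -X e) = fun e => -reorientSign R X e := by
  funext e
  by_cases h : e ∈ R <;> simp [reorientSign, h]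

theorem signSupport_reorientSign {E : Type*} [Fintype E] [DecidableEq E] (R : Finset E)
    (X : E → SignType) : signSupport (reorientSign R X) = signSupport X := by
  ext e
  have h1 : ∀ Y : E → SignType, e ∈ signSupport Y ↔ Y e ≠ 0 := fun Y => by simp [signSupport]
  rw [h1, h1]
  by_cases h : e ∈ R <;> simp [reorientSign, h]

namespace OrientedMatroid

variable {E : Type*} [Fintype E] [DecidableEq E]

/-- The elimination axiom at an element `e` on which `X` and `Y` have opposite signs, the sign
of `X` being either one. -/
theorem elimination' (M : OrientedMatroid E) (X : E → SignType) (hX : X ∈ M.circuits)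
    (Y : E → SignType) (hY : Y ∈ M.circuits) (hXY : X ≠ fun e => -Y e) (e : E)
    (he : X e ≠ 0) (he' : Y e = -X e) : ∃ Z ∈ M.circuits, Z e = 0 ∧
      ∀ f, Z f ≠ 0 → Z f = X f ∨ Z f = Y f := by
  have key : ∀ X ∈ M.circuits, ∀ Y ∈ M.circuits, (X ≠ fun e => -Y e) → X e = 1 → Y e = -1 →
      ∃ Z ∈ M.circuits, Z e = 0 ∧ ∀ f, Z f ≠ 0 → Z f = X f ∨ Z f = Y f := by
    intro X hX Y hY hXY h1 h2
    obtain ⟨Z, hZ, hp, hn⟩ := M.elimination X hX Y hY hXY e (by simp [signPos, signNeg, h1, h2])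
    refine ⟨Z, hZ, ?_, ?_⟩
    · rcases SignType.trichotomy (Z e) with h | h | h
      · have := hn (by simp [signNeg, h] : e ∈ signNeg Z)
        simp at this
      · exact h
      · have := hp (by simp [signPos, h] : e ∈ signPos Z)
        simp at this
    · intro f hf
      rcases SignType.trichotomy (Z f) with h | h | h
      · have := hn (by simp [signNeg, h] : f ∈ signNeg Z)
        simp only [signNeg, Finset.mem_erase, Finset.mem_union, Finset.mem_filter,
          Finset.mem_univ, true_and] at this
        rw [h]
        rcases this.2 with h | h <;> simp [h]
      · exact absurd h hf
      · have := hp (by simp [signPos, h] : f ∈ signPos Z)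
        simp only [signPos, Finset.mem_erase, Finset.mem_union, Finset.mem_filter,
          Finset.mem_univ, true_and] at this
        rw [h]
        rcases this.2 with h | h <;> simp [h]
  rcases SignType.trichotomy (X e) with h | h | h
  · obtain ⟨Z, hZ, h0, h1⟩ := key Y hY X hX
      (fun H => hXY (by funext f; rw [H]; simp)) (by rw [he', h]; simp) h
    exact ⟨Z, hZ, h0, fun f hf => (h1 f hf).symm⟩
  · exact absurd h he
  · exact key X hX Y hY hXY h (by rw [he', h])

/-- The reorientation `₋R M`: the signs of the elements of `R` are reversed in every circuit. -/
def reorient (M : OrientedMatroid E) (R : Finset E) : OrientedMatroid E where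
  circuits := reorientSign R '' M.circuits
  zero_notMem := by
    rintro ⟨X, hX, h⟩
    apply M.zero_notMem
    have h2 := congrArg (reorientSign R) h
    rw [reorientSign_reorientSign] at h2
    rw [h2] at hX
    convert hX using 1
    funext e
    simp [reorientSign]
  neg_mem := by
    rintro _ ⟨X, hX, rfl⟩
    exact ⟨_, M.neg_mem X hX, reorientSign_neg R X⟩
  incomparable := by
    rintro _ ⟨X, hX, rfl⟩ _ ⟨Y, hY, rfl⟩ h
    rw [signSupport_reorientSign, signSupport_reorientSign] at h
    rcases M.incomparable X hX Y hY h with h | h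
    · exact Or.inl (by rw [h])
    · exact Or.inr (by rw [h, reorientSign_neg])
  elimination := by
    rintro _ ⟨X, hX, rfl⟩ _ ⟨Y, hY, rfl⟩ hXY e he
    simp only [signPos, signNeg, Finset.mem_inter, Finset.mem_filter, Finset.mem_univ,
      true_and] at he
    obtain ⟨Z, hZ, h0, h1⟩ := M.elimination' X hX Y hY
      (fun H => hXY (by rw [H, reorientSign_neg])) e
      (by
        intro h
        by_cases hR : e ∈ R <;> simp [reorientSign, hR, h] at he)
      (by
        by_cases hR : e ∈ R
        · simp only [reorientSign, hR, if_true] at he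
          have h1 : X e = -1 := by rw [← he.1, neg_neg]
          have h2 : Y e = 1 := by rw [← neg_neg (Y e), he.2]; simp
          rw [h1, h2]; simp
        · simp only [reorientSign, hR, if_false] at he
          rw [he.1, he.2])
    have h1' : ∀ f, reorientSign R Z f ≠ 0 →
        reorientSign R Z f = reorientSign R X f ∨ reorientSign R Z f = reorientSign R Y f := by
      intro f hf
      have hf' : Z f ≠ 0 := by
        intro h
        by_cases hR : f ∈ R <;> simp [reorientSign, hR, h] at hf
      rcases h1 f hf' with h | h
      · left; simp [reorientSign, h]
      · right; simp [reorientSign, h]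
    have h0' : reorientSign R Z e = 0 := by simp [reorientSign, h0]
    refine ⟨_, ⟨Z, hZ, rfl⟩, ?_, ?_⟩
    · intro f hf
      simp only [signPos, Finset.mem_filter, Finset.mem_univ, true_and] at hf
      simp only [signPos, Finset.mem_erase, Finset.mem_union, Finset.mem_filter,
        Finset.mem_univ, true_and]
      refine ⟨fun h => ?_, ?_⟩
      · rw [h, h0'] at hf; exact absurd hf (by decide)
      · rcases h1' f (by rw [hf]; decide) with h | h
        · exact Or.inl (by rw [← h, hf])
        · exact Or.inr (by rw [← h, hf])
    · intro f hf
      simp only [signNeg, Finset.mem_filter, Finset.mem_univ, true_and] at hf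
      simp only [signNeg, Finset.mem_erase, Finset.mem_union, Finset.mem_filter,
        Finset.mem_univ, true_and]
      refine ⟨fun h => ?_, ?_⟩
      · rw [h, h0'] at hf; exact absurd hf (by decide)
      · rcases h1' f (by rw [hf]; decide) with h | h
        · exact Or.inl (by rw [← h, hf])
        · exact Or.inr (by rw [← h, hf])

/-- `M` is `k`-neighborly if every circuit has more than `k` positive and more than `k` negative
elements. -/
def IsNeighborly (M : OrientedMatroid E) (k : ℕ) : Prop :=
  ∀ X ∈ M.circuits, k < (signPos X).card ∧ k < (signNeg X).card

open Classical in
/-- The number `f_M(r, n, k)` of `k`-neighborly reorientations of `M`, that is, of subsets `R` of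
the ground set such that `₋R M` is `k`-neighborly (`r` and `n` are determined by `M`). -/
noncomputable def numNeighborlyReorientations (M : OrientedMatroid E) (k : ℕ) : ℕ :=
  ((Finset.univ : Finset (Finset E)).filter fun R => (M.reorient R).IsNeighborly k).card

/-- A set is independent if it does not contain (the support of) a circuit. -/
def Indep (M : OrientedMatroid E) (S : Finset E) : Prop :=
  ∀ X ∈ M.circuits, ¬ signSupport X ⊆ S

open Classical in
/-- The rank: the size of a largest set not containing a circuit. -/
noncomputable def rank (M : OrientedMatroid E) : ℕ :=
  ((Finset.univ : Finset (Finset E)).filter fun S => M.Indep S).sup Finset.card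

/-- A basis is a maximal independent set. -/
def IsBasis (M : OrientedMatroid E) (B : Finset E) : Prop :=
  Maximal M.Indep B

/-- The tuple `x` is an ordered basis of `M`. -/
def IsOrderedBasis (M : OrientedMatroid E) {r : ℕ} (x : Fin r → E) : Prop :=
  Function.Injective x ∧ M.IsBasis (Finset.univ.image x)

/-- `χ` is a chirotope (basis orientation) of the rank `r` oriented matroid `M`: it is alternating,
it is nonzero exactly on the ordered bases of `M`, and if two ordered bases differ by exchanging
the entry `e = x i` for `f ≠ e`, then `χ` changes by the factor `-X_e X_f`, where `X` is a
signed circuit (unique up to sign) contained in the union of the two bases. -/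
structure IsChirotope (M : OrientedMatroid E) (r : ℕ) (χ : (Fin r → E) → SignType) : Prop where
  rank_eq : M.rank = r
  ne_zero_iff : ∀ x, χ x ≠ 0 ↔ M.IsOrderedBasis x
  swap : ∀ (x : Fin r → E) (i j : Fin r), i ≠ j → χ (x ∘ Equiv.swap i j) = -χ x
  pivot : ∀ (x : Fin r → E) (i : Fin r) (f : E), f ≠ x i →
    M.IsOrderedBasis x → M.IsOrderedBasis (Function.update x i f) →
    ∀ X ∈ M.circuits, signSupport X ⊆ insert f (Finset.univ.image x) →
      χ (Function.update x i f) = -(X (x i) * X f) * χ x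

/-- `M` is a Lawrence oriented matroid of rank `r` on the ordered set of `n` elements: for some
`r × n` matrix `A` with entries `+` and `-`, a chirotope of `M` takes the value `∏ i, A i (j i)`
at every increasing tuple `j`. -/
def IsLOM {n : ℕ} (M : OrientedMatroid (Fin n)) (r : ℕ) : Prop :=
  ∃ A : Matrix (Fin r) (Fin n) SignType, (∀ i j, A i j ≠ 0) ∧
    ∃ χ : (Fin r → Fin n) → SignType, M.IsChirotope r χ ∧
      ∀ j : Fin r → Fin n, StrictMono j → χ j = ∏ i, A i (j i)

end OrientedMatroid

/-- The sign vector `X` is alternating: any two consecutive elements of its support have opposite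
signs. -/
def IsAlternatingSign {n : ℕ} (X : Fin n → SignType) : Prop :=
  ∀ i j, i < j → X i ≠ 0 → X j ≠ 0 → (∀ l, i < l → l < j → X l = 0) → X i = -X j

theorem IsAlternatingSign.exists_chain {n m : ℕ} {X : Fin n → SignType}
    (hX : IsAlternatingSign X) (hc : (signSupport X).card = m + 1) :
    ∃ (x : Fin (m + 1) → Fin n) (s : SignType), StrictMono x ∧ s ≠ 0 ∧
      (∀ i, X (x i) = s * (-1) ^ (i : ℕ)) ∧ ∀ e, X e ≠ 0 → ∃ i, x i = e := by
  have hmem : ∀ e, X e ≠ 0 ↔ ∃ i, (signSupport X).orderEmbOfFin hc i = e := by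
    intro e
    have := Finset.range_orderEmbOfFin (signSupport X) hc
    have h2 : e ∈ Set.range ((signSupport X).orderEmbOfFin hc) ↔ e ∈ (signSupport X) := by
      rw [this]; simp
    rw [Set.mem_range] at h2
    rw [h2]
    simp [signSupport]
  set x := (signSupport X).orderEmbOfFin hc with hx
  refine ⟨x, X (x 0), x.strictMono, (hmem _).2 ⟨0, rfl⟩, ?_, fun e he => (hmem e).1 he⟩
  have key : ∀ (i : ℕ) (hi : i < m + 1), X (x ⟨i, hi⟩) = X (x 0) * (-1) ^ i := by
    intro i
    induction i with
    | zero => intro hi; simp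
    | succ i ih =>
      intro hi
      have h := hX (x ⟨i, by omega⟩) (x ⟨i + 1, hi⟩) (x.strictMono (by simp [Fin.lt_def]))
        ((hmem _).2 ⟨_, rfl⟩) ((hmem _).2 ⟨_, rfl⟩) (by
          intro l h1 h2
          by_contra hl
          obtain ⟨j, rfl⟩ := (hmem l).1 hl
          have h3 := x.lt_iff_lt.1 h1
          have h4 := x.lt_iff_lt.1 h2
          simp only [Fin.lt_def] at h3 h4
          omega)
      rw [ih] at h
      rw [pow_succ, ← mul_assoc, h]
      simp
  intro i
  exact key i i.2

theorem IsAlternatingSign.of_chain {n m : ℕ} (x : Fin (m + 1) → Fin n) (hx : StrictMono x)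
    (s : SignType) (hs : s ≠ 0) :
    ∃ Z : Fin n → SignType, (signSupport Z).card = m + 1 ∧ IsAlternatingSign Z ∧
      (∀ i, Z (x i) = s * (-1) ^ (i : ℕ)) ∧ ∀ e, Z e ≠ 0 → ∃ i, x i = e := by
  classical
  let Z : Fin n → SignType := fun e =>
    if h : ∃ i, x i = e then s * (-1) ^ ((h.choose : Fin (m + 1)) : ℕ) else 0
  have hZ : ∀ i, Z (x i) = s * (-1) ^ (i : ℕ) := by
    intro i
    have h : ∃ j, x j = x i := ⟨i, rfl⟩
    have h2 : h.choose = i := hx.injective h.choose_spec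
    simp only [Z, dif_pos h, h2]
  have hpow : ∀ i : ℕ, ((-1 : SignType)) ^ i ≠ 0 := fun i => pow_ne_zero i (by decide)
  have hZ0 : ∀ e, Z e ≠ 0 → ∃ i, x i = e := by
    intro e he
    by_contra h
    exact he (by simp only [Z, dif_neg h])
  have hZ1 : ∀ i, Z (x i) ≠ 0 := fun i => by
    rw [hZ]; exact mul_ne_zero hs (hpow _)
  refine ⟨Z, ?_, ?_, hZ, hZ0⟩
  · have : signSupport Z = Finset.univ.image x := by
      ext e
      simp only [signSupport, Finset.mem_filter, Finset.mem_univ, true_and, Finset.mem_image]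
      exact ⟨hZ0 e, fun ⟨i, hi⟩ => hi ▸ hZ1 i⟩
    rw [this, Finset.card_image_of_injective _ hx.injective]
    simp
  · intro a b hab ha hb hl
    obtain ⟨i, rfl⟩ := hZ0 a ha
    obtain ⟨j, rfl⟩ := hZ0 b hb
    have hij : i < j := hx.lt_iff_lt.1 hab
    have h1 : (j : ℕ) = i + 1 := by
      by_contra h
      rw [Fin.lt_def] at hij
      have hlt : (i : ℕ) + 1 < m + 1 := by omega
      exact hZ1 ⟨i + 1, hlt⟩ (hl _ (hx (by simp [Fin.lt_def]))
        (hx (by simp only [Fin.lt_def]; omega)))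
    rw [hZ, hZ, h1, pow_succ]
    cases s <;> cases (-1 : SignType) ^ (i : ℕ) <;> decide

theorem neg_one_pow_add_sign (a b : ℕ) (h : a % 2 = b % 2) :
    (-1 : SignType) ^ a = (-1) ^ b := by
  rcases Nat.even_or_odd a with ha | ha
  · have hb : Even b := by rw [Nat.even_iff] at *; omega
    rw [ha.neg_one_pow, hb.neg_one_pow]
  · have hb : Odd b := by rw [Nat.odd_iff] at *; omega
    rw [ha.neg_one_pow, hb.neg_one_pow]

/-- Elimination between two alternating chains of opposite signs at a common entry. -/
theorem alternating_chain_elimination {n r : ℕ} (x y : Fin (r + 1) → Fin n) (hx : StrictMono x)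
    (hy : StrictMono y) (s t : SignType) (hs : s ≠ 0) (ht : t ≠ 0) (p q : Fin (r + 1))
    (hpq : x p = y q) (hsgn : s * (-1) ^ (p : ℕ) = -(t * (-1) ^ (q : ℕ)))
    (hlex : q < p ∨ (p = q ∧ ∃ i, x i < y i)) :
    ∃ (z : Fin (r + 1) → Fin n) (u : SignType), StrictMono z ∧ u ≠ 0 ∧ ∀ i, z i ≠ x p ∧
      ((∃ j, z i = x j ∧ u * (-1) ^ (i : ℕ) = s * (-1) ^ (j : ℕ)) ∨
       (∃ j, z i = y j ∧ u * (-1) ^ (i : ℕ) = t * (-1) ^ (j : ℕ))) := by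
  have hst : s = t * (-1) ^ ((p : ℕ) + q + 1) := by
    have h1 : s * (-1) ^ (p : ℕ) * (-1) ^ (p : ℕ) = s := by
      rw [mul_assoc, ← pow_add, Even.neg_one_pow ⟨_, rfl⟩, mul_one]
    rw [← h1, hsgn, pow_succ, pow_add]
    cases t <;> cases (-1 : SignType) ^ (p : ℕ) <;> cases (-1 : SignType) ^ (q : ℕ) <;> decide
  have hts : t = s * (-1) ^ ((p : ℕ) + q + 1) := by
    rw [hst, mul_assoc, ← pow_add, Even.neg_one_pow ⟨_, rfl⟩, mul_one]
  rcases hlex with hlt | ⟨rfl, i, hi⟩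
  · rw [Fin.lt_def] at hlt
    refine ⟨fun j => if h : j < p then x j else y ⟨(j : ℕ) - p + q + 1, by
      have := j.2; simp only [Fin.lt_def] at h; omega⟩, s, ?_, hs, ?_⟩
    · intro a b hab
      rw [Fin.lt_def] at hab
      by_cases ha : a < p <;> by_cases hb : b < p <;> simp only [ha, hb, dite_true, dite_false]
      · exact hx hab
      · refine (hx ha).trans ?_
        rw [hpq]
        apply hy
        simp only [Fin.lt_def]; omega
      · simp only [Fin.lt_def] at ha hb; omega
      · apply hy
        simp only [Fin.lt_def] at *; omega
    · intro a
      by_cases ha : a < p <;> simp only [ha, dite_true, dite_false]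
      · exact ⟨(hx ha).ne, Or.inl ⟨a, rfl, rfl⟩⟩
      · refine ⟨?_, Or.inr ⟨_, rfl, ?_⟩⟩
        · rw [hpq]
          apply ne_of_gt
          apply hy
          simp only [Fin.lt_def]; omega
        · rw [hst, mul_assoc, ← pow_add]
          congr 1
          apply neg_one_pow_add_sign
          simp only [Fin.lt_def] at ha ⊢
          omega
  · rcases lt_trichotomy i p with hip | rfl | hip
    · rw [Fin.lt_def] at hip
      refine ⟨fun j => if h : i < j ∧ j ≤ p then y ⟨(j : ℕ) - 1, by omega⟩ else x j, s, ?_, hs, ?_⟩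
      · intro a b hab
        rw [Fin.lt_def] at hab
        by_cases ha : i < a ∧ a ≤ p <;> by_cases hb : i < b ∧ b ≤ p <;>
          simp only [ha, hb, dite_true, dite_false] <;> simp only [Fin.lt_def, Fin.le_def] at ha hb
        · apply hy; simp only [Fin.lt_def]; omega
        · have h1 : y ⟨(a : ℕ) - 1, by omega⟩ < y p := by
            apply hy; simp only [Fin.lt_def]; omega
          refine h1.trans ?_
          rw [← hpq]
          apply hx; simp only [Fin.lt_def]; omega
        · have h1 : x a ≤ x i := hx.monotone (by simp only [Fin.le_def]; omega)
          have h2 : y i ≤ y ⟨(b : ℕ) - 1, by omega⟩ :=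
            hy.monotone (by simp only [Fin.le_def]; omega)
          exact (h1.trans_lt hi).trans_le h2
        · exact hx hab
      · intro a
        by_cases ha : i < a ∧ a ≤ p <;> simp only [ha, dite_true, dite_false] <;>
          simp only [Fin.lt_def, Fin.le_def] at ha
        · refine ⟨?_, Or.inr ⟨_, rfl, ?_⟩⟩
          · rw [hpq]
            apply ne_of_lt
            apply hy
            simp only [Fin.lt_def]; omega
          · rw [hst, mul_assoc, ← pow_add]
            congr 1
            apply neg_one_pow_add_sign
            simp only
            omega
        · refine ⟨hx.injective.ne ?_, Or.inl ⟨a, rfl, rfl⟩⟩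
          rintro rfl
          omega
    · exact absurd hpq hi.ne
    · rw [Fin.lt_def] at hip
      refine ⟨fun j => if h : p ≤ j ∧ j < i then x ⟨(j : ℕ) + 1, by
        have := i.2; simp only [Fin.lt_def] at h; omega⟩ else y j, t, ?_, ht, ?_⟩
      · intro a b hab
        rw [Fin.lt_def] at hab
        by_cases ha : p ≤ a ∧ a < i <;> by_cases hb : p ≤ b ∧ b < i <;>
          simp only [ha, hb, dite_true, dite_false] <;> simp only [Fin.lt_def, Fin.le_def] at ha hb
        · apply hx; simp only [Fin.lt_def]; omega
        · have h1 : x ⟨(a : ℕ) + 1, by omega⟩ ≤ x i :=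
            hx.monotone (by simp only [Fin.le_def]; omega)
          have h2 : y i ≤ y b := hy.monotone (by simp only [Fin.le_def]; omega)
          exact (h1.trans_lt hi).trans_le h2
        · have h1 : y a < y p := by
            apply hy; simp only [Fin.lt_def]; omega
          refine h1.trans ?_
          rw [← hpq]
          apply hx; simp only [Fin.lt_def]; omega
        · exact hy hab
      · intro a
        by_cases ha : p ≤ a ∧ a < i <;> simp only [ha, dite_true, dite_false] <;>
          simp only [Fin.lt_def, Fin.le_def] at ha
        · refine ⟨?_, Or.inl ⟨_, rfl, ?_⟩⟩
          · apply ne_of_gt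
            apply hx
            simp only [Fin.lt_def]; omega
          · rw [hts, mul_assoc, ← pow_add]
            congr 1
            apply neg_one_pow_add_sign
            simp only
            omega
        · refine ⟨?_, Or.inr ⟨a, rfl, rfl⟩⟩
          rw [hpq]
          apply hy.injective.ne
          rintro rfl
          omega

/-- The alternating oriented matroid `C_r(n)` on the ordered set of `n` elements: the circuits are
all alternating sign vectors with support of size `r + 1`. -/
def alternatingOrientedMatroid (r n : ℕ) : OrientedMatroid (Fin n) where
  circuits := {X | (signSupport X).card = r + 1 ∧ IsAlternatingSign X}
  zero_notMem := by
    rintro ⟨h, -⟩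
    simp [signSupport] at h
  neg_mem := by
    rintro X ⟨h1, h2⟩
    refine ⟨?_, ?_⟩
    · rw [← h1]
      congr 1
      ext e
      simp [signSupport]
    · intro i j hij hi hj hl
      have h3 := h2 i j hij (by simpa using hi) (by simpa using hj)
        (fun l h h' => by simpa using hl l h h')
      simp only [h3]
  incomparable := by
    rintro X ⟨hX, hX'⟩ Y ⟨hY, hY'⟩ hXY
    have hS : signSupport X = signSupport Y := Finset.eq_of_subset_of_card_le hXY (by omega)
    obtain ⟨x, s, hx, hs, hxs, hxe⟩ := hX'.exists_chain hX
    obtain ⟨y, t, hy, ht, hyt, hye⟩ := hY'.exists_chain hY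
    have hiff : ∀ e, X e ≠ 0 ↔ Y e ≠ 0 := by
      intro e
      have : e ∈ signSupport X ↔ e ∈ signSupport Y := by rw [hS]
      simpa [signSupport] using this
    have hpow : ∀ i : ℕ, ((-1 : SignType)) ^ i ≠ 0 := fun i => pow_ne_zero i (by decide)
    have hxy : x = y := by
      apply StrictMono.range_inj hx hy |>.1
      ext e
      constructor
      · rintro ⟨i, rfl⟩
        exact hye _ ((hiff _).1 (by rw [hxs]; exact mul_ne_zero hs (hpow _)))
      · rintro ⟨i, rfl⟩
        exact hxe _ ((hiff _).2 (by rw [hyt]; exact mul_ne_zero ht (hpow _)))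
    subst hxy
    have hzero : ∀ e, (¬ ∃ i, x i = e) → X e = 0 ∧ Y e = 0 := fun e he =>
      ⟨by by_contra h; exact he (hxe e h), by by_contra h; exact he (hye e h)⟩
    by_cases hst : s = t
    · left
      funext e
      by_cases he : ∃ i, x i = e
      · obtain ⟨i, rfl⟩ := he
        rw [hxs, hyt, hst]
      · rw [(hzero e he).1, (hzero e he).2]
    · right
      have hst' : s = -t := by revert hs ht hst; cases s <;> cases t <;> decide
      funext e
      by_cases he : ∃ i, x i = e
      · obtain ⟨i, rfl⟩ := he
        rw [hxs, hyt, hst']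
        cases t <;> cases (-1 : SignType) ^ (i : ℕ) <;> decide
      · rw [(hzero e he).1, (hzero e he).2]; decide
  elimination := by
    have main : ∀ (X : Fin n → SignType), (signSupport X).card = r + 1 → IsAlternatingSign X →
        ∀ Y : Fin n → SignType, (signSupport Y).card = r + 1 → IsAlternatingSign Y →
        (X ≠ fun e => -Y e) → ∀ e, X e ≠ 0 → Y e = -X e →
        ∃ Z : Fin n → SignType, ((signSupport Z).card = r + 1 ∧ IsAlternatingSign Z) ∧
          Z e = 0 ∧ ∀ f, Z f ≠ 0 → Z f = X f ∨ Z f = Y f := by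
      intro X hX hX' Y hY hY' hXY e he he'
      obtain ⟨x, s, hx, hs, hxs, hxe⟩ := hX'.exists_chain hX
      obtain ⟨y, t, hy, ht, hyt, hye⟩ := hY'.exists_chain hY
      obtain ⟨p, rfl⟩ := hxe e he
      obtain ⟨q, hq⟩ := hye (x p) (by rw [he']; revert he; cases X (x p) <;> decide)
      have hsgn : s * (-1) ^ (p : ℕ) = -(t * (-1) ^ (q : ℕ)) := by
        rw [← hxs, ← hyt, hq, he', neg_neg]
      have hsgn' : t * (-1) ^ (q : ℕ) = -(s * (-1) ^ (p : ℕ)) := by rw [hsgn, neg_neg]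
      have fin : ∀ (z : Fin (r + 1) → Fin n) (u : SignType), StrictMono z → u ≠ 0 →
          (∀ i, z i ≠ x p ∧
            ((∃ j, z i = x j ∧ u * (-1) ^ (i : ℕ) = s * (-1) ^ (j : ℕ)) ∨
            (∃ j, z i = y j ∧ u * (-1) ^ (i : ℕ) = t * (-1) ^ (j : ℕ)))) →
          ∃ Z : Fin n → SignType, ((signSupport Z).card = r + 1 ∧ IsAlternatingSign Z) ∧
            Z (x p) = 0 ∧ ∀ f, Z f ≠ 0 → Z f = X f ∨ Z f = Y f := by
        intro z u hz hu h
        obtain ⟨Z, h1, h2, h3, h4⟩ := IsAlternatingSign.of_chain z hz u hu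
        refine ⟨Z, ⟨h1, h2⟩, ?_, ?_⟩
        · by_contra hne
          obtain ⟨i, hi⟩ := h4 _ hne
          exact (h i).1 hi
        · intro f hf
          obtain ⟨i, rfl⟩ := h4 f hf
          rcases (h i).2 with ⟨j, hj, hj'⟩ | ⟨j, hj, hj'⟩
          · left; rw [h3, hj', hj, hxs]
          · right; rw [h3, hj', hj, hyt]
      rcases lt_trichotomy q p with hlt | heq | hlt
      · obtain ⟨z, u, hz, hu, h⟩ := alternating_chain_elimination x y hx hy s t hs ht p q hq.symm
          hsgn (Or.inl hlt)
        exact fin z u hz hu h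
      · subst heq
        have hne : ∃ i, x i ≠ y i := by
          by_contra! hall
          apply hXY
          have hxy : x = y := funext hall
          subst hxy
          have hst' : s = -t := by
            revert hsgn
            have := pow_ne_zero (q : ℕ) (show (-1 : SignType) ≠ 0 by decide)
            revert this
            cases s <;> cases t <;> cases (-1 : SignType) ^ (q : ℕ) <;> decide
          funext e
          by_cases hh : ∃ i, x i = e
          · obtain ⟨i, rfl⟩ := hh
            rw [hxs, hyt, hst']
            cases t <;> cases (-1 : SignType) ^ (i : ℕ) <;> decide
          · have h1 : X e = 0 := by by_contra h; exact hh (hxe e h)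
            have h2 : Y e = 0 := by by_contra h; exact hh (hye e h)
            rw [h1, h2]; decide
        obtain ⟨i, hi⟩ := hne
        rcases lt_or_gt_of_ne hi with hi | hi
        · obtain ⟨z, u, hz, hu, h⟩ := alternating_chain_elimination x y hx hy s t hs ht q q
            hq.symm hsgn (Or.inr ⟨rfl, i, hi⟩)
          exact fin z u hz hu h
        · obtain ⟨z, u, hz, hu, h⟩ := alternating_chain_elimination y x hy hx t s ht hs q q
            hq hsgn' (Or.inr ⟨rfl, i, hi⟩)
          exact fin z u hz hu fun i => ⟨hq ▸ (h i).1, (h i).2.symm⟩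
      · obtain ⟨z, u, hz, hu, h⟩ := alternating_chain_elimination y x hy hx t s ht hs q p
            hq hsgn' (Or.inl hlt)
        exact fin z u hz hu fun i => ⟨hq ▸ (h i).1, (h i).2.symm⟩
    rintro X ⟨hX, hX'⟩ Y ⟨hY, hY'⟩ hXY e he
    simp only [signPos, signNeg, Finset.mem_inter, Finset.mem_filter, Finset.mem_univ,
      true_and] at he
    obtain ⟨Z, hZ, h0, h1⟩ := main X hX hX' Y hY hY' hXY e (by rw [he.1]; decide)
      (by rw [he.1, he.2])
    refine ⟨Z, hZ, ?_, ?_⟩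
    · intro f hf
      simp only [signPos, Finset.mem_filter, Finset.mem_univ, true_and] at hf
      simp only [signPos, Finset.mem_erase, Finset.mem_union, Finset.mem_filter,
        Finset.mem_univ, true_and]
      refine ⟨fun h => ?_, ?_⟩
      · rw [h, h0] at hf; exact absurd hf (by decide)
      · rcases h1 f (by rw [hf]; decide) with h | h
        · exact Or.inl (by rw [← h, hf])
        · exact Or.inr (by rw [← h, hf])
    · intro f hf
      simp only [signNeg, Finset.mem_filter, Finset.mem_univ, true_and] at hf
      simp only [signNeg, Finset.mem_erase, Finset.mem_union, Finset.mem_filter,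
        Finset.mem_univ, true_and]
      refine ⟨fun h => ?_, ?_⟩
      · rw [h, h0] at hf; exact absurd hf (by decide)
      · rcases h1 f (by rw [hf]; decide) with h | h
        · exact Or.inl (by rw [← h, hf])
        · exact Or.inr (by rw [← h, hf])

/-- `c_r(n, k)`: the number of `k`-neighborly reorientations of the alternating oriented matroid
of rank `r` on `n` elements. -/
noncomputable def alternatingCount (r n k : ℕ) : ℕ :=
  (alternatingOrientedMatroid r n).numNeighborlyReorientations k

/-! The proof is an induction on the number of elements, simultaneously for all ranks up to `r`:
numbers of neighborly reorientations of Lawrence oriented matroids satisfy a Pascal-type inequality,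
and those of alternating ones satisfy the reverse inequality.

For a LOM with matrix `A`, dropping the last column gives the deletion of the last element, and
dropping the last row as well gives its contraction. Restricting a `k`-neighborly `R` to the other
elements gives a `k`-neighborly reorientation of the deletion. If a trace comes from two such sets,
it is also `k`-neighborly for the contraction. This gives
`OrientedMatroid.numNeighborlyReorientations_le_add`. Both minors are LOMs again: a matrix of signs
determines the circuits, and every such matrix is realized by real vectors
(`OrientedMatroid.exists_hasLawrenceMatrix`).

For `C_r(n)`, a set `R` is a binary word, and the positive and negative counts of a reoriented
circuit differ by an alternating sum over a subword of length `r + 1`. The crux is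
`isNeighborlyWord_iff_runs_le`: once `n ≥ 2 * (r - k) + 1` and `2 * k ≤ r`, the neighborly words are
those with at most `r - 2 * k` blocks. Prepending a letter then proves `alternatingCount_add_le`.
The induction stops at `n = 2 * (r - k) + 1`, which is the assumed case, or at rank at most `2 * k`,
which is degenerate. -/

/-! ### Alternating sums and blocks of binary words -/

/-- The alternating sum `s₀ - s₁ + s₂ - ⋯` of a word of signs, `true` standing for `-1`. -/
def altSum : List Bool → ℤ
  | [] => 0
  | a :: l => (if a then -1 else 1) - altSum l

/-- The number of maximal constant blocks of a word. -/
def runs : List Bool → ℕ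
  | [] => 0
  | [_] => 1
  | a :: b :: l => runs (b :: l) + if a = b then 0 else 1

theorem altSum_append_pair (t₁ t₂ : List Bool) (a : Bool) :
    altSum (t₁ ++ a :: a :: t₂) = altSum (t₁ ++ t₂) := by
  induction t₁ with
  | nil => simp [altSum]
  | cons b t ih => simp [altSum, ih]

theorem runs_le_runs_cons (a : Bool) (l : List Bool) : runs l ≤ runs (a :: l) := by
  cases l <;> simp [runs]

theorem runs_cons_le (a : Bool) (l : List Bool) : runs (a :: l) ≤ runs l + 1 := by
  cases l with
  | nil => simp [runs]
  | cons b l => simp only [runs]; split_ifs <;> omega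

/-- Keeping a common first letter makes the induction along the sublist relation close; `runs_mono`
is deduced from it. -/
theorem runs_cons_mono {l t : List Bool} (h : t.Sublist l) (a : Bool) :
    runs (a :: t) ≤ runs (a :: l) := by
  induction h generalizing a with
  | slnil => exact le_rfl
  | @cons t l b _ ih =>
    refine (ih a).trans ?_
    by_cases hab : a = b
    · subst hab; simp [runs]
    · have := runs_cons_le a l
      have := runs_le_runs_cons b l
      simp only [runs, hab, if_false]
      omega
  | @cons_cons t l b _ ih =>
    have := ih b
    simp only [runs]
    omega

theorem runs_mono {l t : List Bool} (h : t.Sublist l) : runs t ≤ runs l := by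
  cases h with
  | slnil => exact le_rfl
  | @cons _ l b h =>
    cases t with
    | nil => simp [runs]
    | cons c t =>
      have h' := runs_cons_mono ((List.cons_sublist_cons (a := c)).2
        ((List.sublist_cons_self c t).trans h)) c
      have := runs_cons_mono h b
      have := runs_le_runs_cons b (c :: t)
      omega
  | cons_cons a h => exact runs_cons_mono h a

/-- The bounds are asymmetric because prepending a letter equal to the first one turns a normalized
sum `z` into `1 - z` without adding a block. This exchanges the two bounds exactly. -/
theorem altSum_cons_bounds (a : Bool) (l : List Bool) :
    (if a then -1 else 1) * altSum (a :: l) ≤ runs (a :: l) ∧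
      1 - (runs (a :: l) : ℤ) ≤ (if a then -1 else 1) * altSum (a :: l) := by
  induction l generalizing a with
  | nil => cases a <;> simp [altSum, runs]
  | cons b l ih =>
    have := ih b
    rw [altSum]
    simp only [runs]
    cases a <;> cases b <;> simp at this ⊢ <;> constructor <;> omega

theorem abs_altSum_le_runs (l : List Bool) : |altSum l| ≤ runs l := by
  cases l with
  | nil => simp [altSum, runs]
  | cons a l =>
    have := altSum_cons_bounds a l
    rw [abs_le]
    cases a <;> simp at this ⊢ <;> constructor <;> omega

/-- One letter from each of the first `m` blocks gives an alternating word, whose terms all have the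
sign of its first letter. -/
theorem exists_alternating_sublist_cons (a : Bool) (l : List Bool) (m : ℕ)
    (h : m ≤ runs (a :: l)) : ∃ t : List Bool, t.Sublist (a :: l) ∧ t.length = m ∧
      (if a then -1 else 1) * altSum t = m := by
  induction l generalizing a m with
  | nil =>
    simp only [runs] at h
    interval_cases m
    · exact ⟨[], by simp, rfl, by simp [altSum]⟩
    · exact ⟨[a], by simp, rfl, by cases a <;> simp [altSum]⟩
  | cons b l ih =>
    by_cases hab : a = b
    · subst hab
      obtain ⟨t, h1, h2, h3⟩ := ih a m (by simpa [runs] using h)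
      exact ⟨t, h1.cons _, h2, h3⟩
    · cases m with
      | zero => exact ⟨[], by simp, rfl, by simp [altSum]⟩
      | succ m =>
        obtain ⟨t, h1, h2, h3⟩ := ih b m (by simpa [runs, hab] using h)
        refine ⟨a :: t, h1.cons_cons a, by simp [h2], ?_⟩
        rw [altSum]
        cases a <;> cases b <;> simp at hab h3 ⊢ <;> omega

theorem exists_alternating_sublist (l : List Bool) (m : ℕ) (h : m ≤ runs l) :
    ∃ t : List Bool, t.Sublist l ∧ t.length = m ∧ (m : ℤ) ≤ |altSum t| := by
  cases l with
  | nil => exact ⟨[], by simp, by simp [runs] at h; simp [h], by simp [runs] at h; simp [h]⟩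
  | cons a l =>
    obtain ⟨t, h1, h2, h3⟩ := exists_alternating_sublist_cons a l m h
    refine ⟨t, h1, h2, ?_⟩
    rw [← h3]
    cases a
    · simpa using le_abs_self _
    · simpa using neg_le_abs _

theorem runs_append_pair (u v : List Bool) (a : Bool) :
    runs (u ++ a :: a :: v) = runs (u ++ a :: v) := by
  induction u with
  | nil => simp [runs]
  | cons x u ih => cases u <;> simp_all [runs]

theorem runs_append_cons_le (u v : List Bool) (a : Bool) :
    runs (u ++ a :: v) ≤ runs (u ++ v) + 2 := by
  induction u with
  | nil => exact (runs_cons_le a v).trans (by simp)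
  | cons x u ih =>
    cases u with
    | nil =>
      have h1 := runs_cons_le x (a :: v)
      have h2 := runs_cons_le a v
      have h3 := runs_le_runs_cons x v
      simp only [List.cons_append, List.nil_append]
      omega
    | cons y u =>
      simp only [List.cons_append, runs] at ih ⊢
      omega

theorem runs_concat_le (u : List Bool) (a : Bool) : runs (u ++ [a]) ≤ runs u + 1 := by
  induction u with
  | nil => simp [runs]
  | cons x u ih =>
    cases u with
    | nil => exact (runs_cons_le x [a]).trans (by simp [runs])
    | cons y u =>
      simp only [List.cons_append, runs] at ih ⊢
      omega

theorem exists_pair_or_runs_eq_length (l : List Bool) :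
    (∃ u a v, l = u ++ a :: a :: v) ∨ runs l = l.length := by
  induction l with
  | nil => right; rfl
  | cons a l ih =>
    cases l with
    | nil => right; rfl
    | cons b l =>
      rcases ih with ⟨u, c, v, h⟩ | h
      · exact Or.inl ⟨a :: u, c, v, by simp [h]⟩
      · by_cases hab : a = b
        · exact Or.inl ⟨[], a, l, by simp [hab]⟩
        · right; simp [runs, hab] at h ⊢; exact h

/-- Without a block of length three a word has length at most twice the number of its blocks, with
equality only if its last block has length two. -/
theorem exists_triple_or_length_le : ∀ (a : Bool) (l : List Bool),
    (∃ u c v, a :: l = u ++ c :: c :: c :: v) ∨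
      ((a :: l).length ≤ 2 * runs (a :: l) ∧
        ((∃ u c, a :: l = u ++ [c, c]) ∨ (a :: l).length + 1 ≤ 2 * runs (a :: l)))
  | a, [] => Or.inr ⟨by simp [runs], Or.inr (by simp [runs])⟩
  | a, [b] => by
    right
    by_cases hab : a = b
    · exact ⟨by simp [runs, hab], Or.inl ⟨[], a, by simp [hab]⟩⟩
    · exact ⟨by simp [runs, hab], Or.inr (by simp [runs, hab])⟩
  | a, b :: c :: l => by
    by_cases hab : a = b
    · by_cases hbc : b = c
      · exact Or.inl ⟨[], a, l, by simp [hab, hbc]⟩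
      · rcases exists_triple_or_length_le c l with ⟨u, d, v, h⟩ | ⟨h1, h2⟩
        · exact Or.inl ⟨a :: b :: u, d, v, by simp [h]⟩
        · have h3 : runs (a :: b :: c :: l) = runs (c :: l) + 1 := by simp [runs, hab, hbc]
          refine Or.inr ⟨by simp only [List.length_cons] at h1 ⊢; omega, ?_⟩
          rcases h2 with ⟨u, d, h⟩ | h2
          · exact Or.inl ⟨a :: b :: u, d, by simp [h]⟩
          · exact Or.inr (by simp only [List.length_cons] at h2 ⊢; omega)
    · rcases exists_triple_or_length_le b (c :: l) with ⟨u, d, v, h⟩ | ⟨h1, h2⟩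
      · exact Or.inl ⟨a :: u, d, v, by simp [h]⟩
      · have h3 : runs (a :: b :: c :: l) = runs (b :: c :: l) + 1 := by
          rw [runs, if_neg hab]
        refine Or.inr ⟨by simp only [List.length_cons] at h1 ⊢; omega, ?_⟩
        rcases h2 with ⟨u, d, h⟩ | h2
        · exact Or.inl ⟨a :: u, d, by simp [h]⟩
        · exact Or.inr (by simp only [List.length_cons] at h2 ⊢; omega)

/-- A long word with enough blocks has two equal consecutive letters that can be removed so that
enough blocks remain, unless it is alternating. -/
theorem exists_removable_pair (l : List Bool) (m : ℕ) (hm : 1 ≤ m) (hl : 2 * m + 1 ≤ l.length)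
    (hr : m ≤ runs l) :
    (∃ u a v, l = u ++ a :: a :: v ∧ m ≤ runs (u ++ v)) ∨ runs l = l.length := by
  rcases exists_pair_or_runs_eq_length l with ⟨u, a, v, h⟩ | h
  swap
  · exact Or.inr h
  left
  -- Removing a pair loses at most two blocks, so with two blocks to spare any pair will do.
  by_cases h2 : m + 2 ≤ runs l
  · refine ⟨u, a, v, h, ?_⟩
    have := runs_append_cons_le u v a
    rw [h, runs_append_pair] at h2
    omega
  -- Two letters of a block of length at least three can be removed without losing a block.
  have triple : ∀ u c v, l = u ++ c :: c :: c :: v →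
      ∃ u a v, l = u ++ a :: a :: v ∧ m ≤ runs (u ++ v) := by
    rintro u c v rfl
    refine ⟨u, c, c :: v, rfl, ?_⟩
    rw [runs_append_pair, runs_append_pair] at hr
    exact hr
  match l, hl, hr, h2, triple with
  | [_], hl, _, _, _ => simp at hl; omega
  | a :: b :: l, hl, hr, h2, triple =>
    rcases exists_triple_or_length_le a (b :: l) with ⟨u, c, v, h⟩ | ⟨h0, -⟩
    · exact triple u c v h
    rcases exists_triple_or_length_le b l with ⟨u, c, v, h⟩ | ⟨h1, h3⟩
    · exact triple (a :: u) c v (by simp [h])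
    -- All blocks now have length at most two, and there are exactly `m + 1` of them on at least `2
    -- * m + 1` letters. So at most one block is a single letter, and the first or the last block is
    -- a pair. Removing a pair at an end costs only one block.
    by_cases hab : a = b
    · subst hab
      have h4 : runs (a :: a :: l) = runs (a :: l) := by simp [runs]
      simp only [List.length_cons] at h0 h1 hl
      refine ⟨[], a, l, rfl, ?_⟩
      have := runs_cons_le a l
      simp only [List.nil_append]
      omega
    · have h4 : runs (a :: b :: l) = runs (b :: l) + 1 := by rw [runs, if_neg hab]
      simp only [List.length_cons] at h0 h1 h3 hl
      rcases h3 with ⟨u, c, h⟩ | h3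
      · refine ⟨a :: u, c, [], by simp [h], ?_⟩
        have h5 : runs (a :: b :: l) = runs ((a :: u) ++ [c]) := by
          rw [h, ← runs_append_pair]; simp
        have := runs_concat_le (a :: u) c
        simp only [List.append_nil]
        omega
      · omega

/-- A removable pair is taken out, the induction hypothesis is applied, and the pair is put back at
its place in the subword, where it contributes zero to the alternating sum. If no pair is removable
the word is alternating, and it is long enough to contain an alternating subword of the full length.
-/
theorem exists_sublist_le_abs_altSum (k m : ℕ) (hm : 1 ≤ m) (l : List Bool)
    (hl : 2 * m + 2 * k ≤ l.length + 1) (hr : m ≤ runs l) :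
    ∃ t : List Bool, t.Sublist l ∧ t.length = m + 2 * k ∧ (m : ℤ) ≤ |altSum t| := by
  induction k generalizing l with
  | zero => exact exists_alternating_sublist l m hr
  | succ k ih =>
    rcases exists_removable_pair l m hm (by omega) hr with ⟨u, a, v, rfl, h⟩ | h
    · obtain ⟨t, h1, h2, h3⟩ := ih (u ++ v) (by simp at hl ⊢; omega) h
      obtain ⟨t₁, t₂, rfl, h4, h5⟩ := List.sublist_append_iff.1 h1
      refine ⟨t₁ ++ a :: a :: t₂, h4.append ((h5.cons_cons a).cons_cons a), ?_, ?_⟩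
      · simp at h2 ⊢; omega
      · rwa [altSum_append_pair]
    · obtain ⟨t, h1, h2, h3⟩ := exists_alternating_sublist l (m + 2 * (k + 1)) (by omega)
      exact ⟨t, h1, h2, le_trans (by push_cast; omega) h3⟩

/-! ### Circuits of a Lawrence oriented matroid -/

/-- `X` is a signed circuit of the Lawrence oriented matroid with matrix `A`: its support is
`x 0 < ⋯ < x r`, and the signs at `x j` and `x (j + 1)` are related by the `j`-th row of `A`. -/
def IsLawrenceCircuit {r n : ℕ} (A : Matrix (Fin r) (Fin n) SignType) (X : Fin n → SignType) :
    Prop :=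
  ∃ x : Fin (r + 1) → Fin n, StrictMono x ∧ (∀ e, X e ≠ 0 ↔ e ∈ Set.range x) ∧
    ∀ j : Fin r, X (x j.succ) = -(X (x j.castSucc) * A j (x j.castSucc) * A j (x j.succ))

/-- The rule carries the sign at `x 0` along the whole chain. -/
theorem eq_or_eq_neg_of_lawrence_chain {r n : ℕ} {A : Matrix (Fin r) (Fin n) SignType}
    {X Y : Fin n → SignType} {x : Fin (r + 1) → Fin n}
    (hX : ∀ e, X e ≠ 0 ↔ e ∈ Set.range x) (hY : ∀ e, Y e ≠ 0 ↔ e ∈ Set.range x)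
    (hX' : ∀ j : Fin r, X (x j.succ) = -(X (x j.castSucc) * A j (x j.castSucc) * A j (x j.succ)))
    (hY' : ∀ j : Fin r, Y (x j.succ) = -(Y (x j.castSucc) * A j (x j.castSucc) * A j (x j.succ))) :
    X = Y ∨ X = fun e => -Y e := by
  have key : ∀ c : SignType, X (x 0) = c * Y (x 0) → ∀ e, X e = c * Y e := by
    intro c hc e
    by_cases he : e ∈ Set.range x
    · obtain ⟨i, rfl⟩ := he
      induction i using Fin.induction with
      | zero => exact hc
      | succ i ih =>
        rw [hX', hY', ih]
        cases c <;> cases Y (x i.castSucc) <;> cases A i (x i.castSucc) <;>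
          cases A i (x i.succ) <;> rfl
    · have h1 : X e = 0 := not_not.1 fun h => he ((hX e).1 h)
      have h2 : Y e = 0 := not_not.1 fun h => he ((hY e).1 h)
      simp [h1, h2]
  have h1 := (hX (x 0)).2 ⟨0, rfl⟩
  have h2 := (hY (x 0)).2 ⟨0, rfl⟩
  have h3 : X (x 0) = 1 * Y (x 0) ∨ X (x 0) = -1 * Y (x 0) := by
    revert h1 h2
    cases X (x 0) <;> cases Y (x 0) <;> decide
  rcases h3 with h | h
  · left; funext e; simpa using key 1 h e
  · right; funext e; simpa using key (-1) h e

namespace OrientedMatroid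

/-- `A` is a matrix of the Lawrence oriented matroid `M`. -/
def HasLawrenceMatrix {r n : ℕ} (M : OrientedMatroid (Fin n))
    (A : Matrix (Fin r) (Fin n) SignType) : Prop :=
  (∀ i j, A i j ≠ 0) ∧ ∃ χ : (Fin r → Fin n) → SignType, M.IsChirotope r χ ∧
    ∀ j : Fin r → Fin n, StrictMono j → χ j = ∏ i, A i (j i)

theorem HasLawrenceMatrix.rank_le {r n : ℕ} {M : OrientedMatroid (Fin n)}
    {A : Matrix (Fin r) (Fin n) SignType} (h : M.HasLawrenceMatrix A) : r ≤ n := by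
  obtain ⟨-, χ, hχ, -⟩ := h
  rw [← hχ.rank_eq]
  exact Finset.sup_le fun S _ => (Finset.card_le_univ S).trans (by simp)

/-- A product of nonzero signs is nonzero, so the matroid is uniform. -/
theorem HasLawrenceMatrix.isBasis {r n : ℕ} {M : OrientedMatroid (Fin n)}
    {A : Matrix (Fin r) (Fin n) SignType} (h : M.HasLawrenceMatrix A) (T : Finset (Fin n))
    (hT : T.card = r) : M.IsBasis T := by
  obtain ⟨hA, χ, hχ, hχA⟩ := h
  have h1 : χ (T.orderEmbOfFin hT) ≠ 0 := by
    rw [hχA _ (T.orderEmbOfFin hT).strictMono]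
    exact Finset.prod_ne_zero_iff.2 fun i _ => hA _ _
  have h2 := ((hχ.ne_zero_iff _).1 h1).2
  have h3 : Finset.univ.image (T.orderEmbOfFin hT) = T := by
    apply Finset.coe_injective
    simp
  rwa [h3] at h2

theorem HasLawrenceMatrix.lt_card_signSupport {r n : ℕ} {M : OrientedMatroid (Fin n)}
    {A : Matrix (Fin r) (Fin n) SignType} (h : M.HasLawrenceMatrix A) {X : Fin n → SignType}
    (hX : X ∈ M.circuits) : r < (signSupport X).card := by
  by_contra! hc
  obtain ⟨T, hT, hcard⟩ := Finset.exists_superset_card_eq hc (by simpa using h.rank_le)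
  exact (h.isBasis T hcard).1 X hX hT

theorem HasLawrenceMatrix.exists_circuit {r n : ℕ} {M : OrientedMatroid (Fin n)}
    {A : Matrix (Fin r) (Fin n) SignType} (h : M.HasLawrenceMatrix A) (T : Finset (Fin n))
    (hT : T.card = r + 1) : ∃ X ∈ M.circuits, signSupport X = T := by
  obtain ⟨T', hT', hcard⟩ := Finset.exists_subset_card_eq (show r ≤ T.card by omega)
  have h1 : ¬ M.Indep T := fun hi => by
    have := Finset.card_le_card ((h.isBasis T' hcard).2 hi hT')
    omega
  simp only [Indep, not_forall, not_not] at h1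
  obtain ⟨X, hX, hs⟩ := h1
  have := h.lt_card_signSupport hX
  exact ⟨X, hX, Finset.eq_of_subset_of_card_le hs (by omega)⟩

theorem HasLawrenceMatrix.card_signSupport {r n : ℕ} {M : OrientedMatroid (Fin n)}
    {A : Matrix (Fin r) (Fin n) SignType} (h : M.HasLawrenceMatrix A) {X : Fin n → SignType}
    (hX : X ∈ M.circuits) : (signSupport X).card = r + 1 := by
  obtain ⟨T, hT, hcard⟩ := Finset.exists_subset_card_eq (h.lt_card_signSupport hX)
  obtain ⟨Y, hY, rfl⟩ := h.exists_circuit T hcard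
  rcases M.incomparable Y hY X hX hT with rfl | rfl
  · exact hcard
  · rw [Nat.succ_eq_add_one] at hcard
    rw [← hcard]
    congr 1
    ext e
    simp [signSupport]

/-- Omitting `x (j + 1)` or `x j` from the support leaves two increasing tuples that differ only in
position `j`. Their chirotope values differ only in the factor from row `j`, and the pivot rule
turns the ratio into a relation between the two signs of `X`. -/
theorem HasLawrenceMatrix.isLawrenceCircuit {r n : ℕ} {M : OrientedMatroid (Fin n)}
    {A : Matrix (Fin r) (Fin n) SignType} (h : M.HasLawrenceMatrix A) {X : Fin n → SignType}
    (hX : X ∈ M.circuits) : IsLawrenceCircuit A X := by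
  have hcard := h.card_signSupport hX
  have hbasis : ∀ y : Fin r → Fin n, Function.Injective y → M.IsOrderedBasis y := fun y hy =>
    ⟨hy, h.isBasis _ (by rw [Finset.card_image_of_injective _ hy]; simp)⟩
  obtain ⟨hA, χ, hχ, hχA⟩ := h
  set x := (signSupport X).orderEmbOfFin hcard with hx
  have hrange : ∀ e, X e ≠ 0 ↔ e ∈ Set.range x := by
    intro e
    rw [hx, Finset.range_orderEmbOfFin]
    simp [signSupport]
  refine ⟨x, x.strictMono, hrange, fun j => ?_⟩
  set y : Fin r → Fin n := x ∘ j.succ.succAbove with hy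
  have hymono : StrictMono y := x.strictMono.comp (Fin.strictMono_succAbove _)
  have hyj : y j = x j.castSucc := by
    simp only [hy, Function.comp]
    rw [Fin.succAbove_of_castSucc_lt _ _ (Fin.castSucc_lt_succ)]
  have hup : Function.update y j (x j.succ) = x ∘ j.castSucc.succAbove := by
    funext i
    rcases lt_trichotomy i j with hij | rfl | hij
    · rw [Function.update_of_ne hij.ne]
      simp only [hy, Function.comp]
      rw [Fin.succAbove_of_castSucc_lt _ _ (by simp only [Fin.lt_def, Fin.val_castSucc, Fin.val_succ] at hij ⊢; omega),
        Fin.succAbove_of_castSucc_lt _ _ (by simp only [Fin.lt_def, Fin.val_castSucc, Fin.val_succ] at hij ⊢; omega)]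
    · rw [Function.update_self]
      simp only [Function.comp]
      rw [Fin.succAbove_of_le_castSucc _ _ le_rfl]
    · rw [Function.update_of_ne hij.ne']
      simp only [hy, Function.comp]
      rw [Fin.succAbove_of_le_castSucc _ _ (by
          simp only [Fin.lt_def, Fin.le_def, Fin.val_castSucc, Fin.val_succ] at hij ⊢; omega),
        Fin.succAbove_of_le_castSucc _ _ (by
          simp only [Fin.lt_def, Fin.le_def, Fin.val_castSucc, Fin.val_succ] at hij ⊢; omega)]
  have hupmono : StrictMono (Function.update y j (x j.succ)) := by
    rw [hup]
    exact x.strictMono.comp (Fin.strictMono_succAbove _)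
  have hp := hχ.pivot y j (x j.succ)
    (by rw [hyj]; exact x.injective.ne (Fin.castSucc_lt_succ).ne')
    (hbasis _ hymono.injective) (hbasis _ hupmono.injective) X hX (by
      intro e he
      obtain ⟨i, rfl⟩ := (hrange e).1 (by simpa [signSupport] using he)
      by_cases hi : i = j.succ
      · simp [hi]
      · obtain ⟨l, rfl⟩ := Fin.exists_succAbove_eq hi
        simp [hy])
  rw [hχA _ hymono, hχA _ hupmono, ← Finset.mul_prod_erase _ _ (Finset.mem_univ j),
    ← Finset.mul_prod_erase _ (fun i => A i (y i)) (Finset.mem_univ j),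
    Function.update_self, hyj] at hp
  have hrest : ∏ i ∈ Finset.univ.erase j, A i (Function.update y j (x j.succ) i)
      = ∏ i ∈ Finset.univ.erase j, A i (y i) :=
    Finset.prod_congr rfl fun i hi => by rw [Function.update_of_ne (Finset.ne_of_mem_erase hi)]
  rw [hrest] at hp
  have hne : ∏ i ∈ Finset.univ.erase j, A i (y i) ≠ 0 :=
    Finset.prod_ne_zero_iff.2 fun i _ => hA _ _
  have h1 := (hrange (x j.castSucc)).2 ⟨_, rfl⟩
  have h2 := (hrange (x j.succ)).2 ⟨_, rfl⟩
  have h3 := hA j (x j.castSucc)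
  have h4 := hA j (x j.succ)
  revert hp hne h1 h2 h3 h4
  generalize ∏ i ∈ Finset.univ.erase j, A i (y i) = a
  generalize X (x j.castSucc) = b
  generalize X (x j.succ) = c
  generalize A j (x j.castSucc) = d
  generalize A j (x j.succ) = f
  cases a <;> cases b <;> cases c <;> cases d <;> cases f <;> decide

/-- The circuits depend on the matrix alone, so any oriented matroid with the reduced matrix can
serve as a deletion or contraction. -/
theorem HasLawrenceMatrix.mem_circuits_iff {r n : ℕ} {M : OrientedMatroid (Fin n)}
    {A : Matrix (Fin r) (Fin n) SignType} (h : M.HasLawrenceMatrix A) (X : Fin n → SignType) :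
    X ∈ M.circuits ↔ IsLawrenceCircuit A X := by
  refine ⟨h.isLawrenceCircuit, ?_⟩
  rintro ⟨x, hx, h1, h2⟩
  obtain ⟨Y, hY, hs⟩ := h.exists_circuit (Finset.univ.image x)
    (by rw [Finset.card_image_of_injective _ hx.injective]; simp)
  have h1Y : ∀ e, Y e ≠ 0 ↔ e ∈ Set.range x := fun e => by
    have : e ∈ signSupport Y ↔ e ∈ Finset.univ.image x := by rw [hs]
    simpa [signSupport] using this
  obtain ⟨y, hy, h3, h4⟩ := h.isLawrenceCircuit hY
  obtain rfl : x = y := (StrictMono.range_inj hx hy).1 (Set.ext fun e => by rw [← h1Y, h3])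
  rcases eq_or_eq_neg_of_lawrence_chain h1 h3 h2 h4 with rfl | rfl
  · exact hY
  · exact M.neg_mem _ hY

end OrientedMatroid

/-! ### Oriented matroids of uniform real matrices -/

/-- Every `r` columns of `V` are linearly independent. -/
def Matrix.IsUniform {r n : ℕ} (V : Matrix (Fin r) (Fin n) ℝ) : Prop :=
  ∀ x : Fin r → Fin n, Function.Injective x → (V.submatrix id x).det ≠ 0

theorem Matrix.mulVec_eq_submatrix_mulVec {r n m : ℕ} (V : Matrix (Fin r) (Fin n) ℝ)
    {x : Fin m → Fin n} (hx : Function.Injective x) {v : Fin n → ℝ}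
    (hv : ∀ e, e ∉ Set.range x → v e = 0) : V.mulVec v = (V.submatrix id x).mulVec (v ∘ x) := by
  funext i
  symm
  exact Fintype.sum_of_injective x hx _ _ (fun e he => by simp [hv e he]) fun j => rfl

namespace Matrix.IsUniform

variable {r n : ℕ} {V : Matrix (Fin r) (Fin n) ℝ}

theorem eq_zero (hV : V.IsUniform) (hr : r ≤ n) {v : Fin n → ℝ} (hv : V.mulVec v = 0)
    {S : Finset (Fin n)} (hS : S.card ≤ r) (hvS : ∀ e, v e ≠ 0 → e ∈ S) : v = 0 := by
  obtain ⟨T, hT, hcard⟩ := Finset.exists_superset_card_eq hS (by simpa using hr)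
  set x := T.orderEmbOfFin hcard
  have hrange : ∀ e, e ∉ Set.range x → v e = 0 := by
    intro e he
    by_contra h
    exact he (by rw [Finset.range_orderEmbOfFin]; exact hT (hvS e h))
  have h0 : v ∘ x = 0 := by
    apply Matrix.eq_zero_of_mulVec_eq_zero (hV x x.injective)
    rw [← V.mulVec_eq_submatrix_mulVec x.injective hrange, hv]
  funext e
  by_cases he : e ∈ Set.range x
  · obtain ⟨i, rfl⟩ := he
    exact congrFun h0 i
  · exact hrange e he

theorem exists_ker_vector (V : Matrix (Fin r) (Fin n) ℝ) {T : Finset (Fin n)}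
    (hT : T.card = r + 1) : ∃ v : Fin n → ℝ, V.mulVec v = 0 ∧ v ≠ 0 ∧ ∀ e, v e ≠ 0 → e ∈ T := by
  set x := T.orderEmbOfFin hT with hx
  have hker : LinearMap.ker (V.submatrix id x).mulVecLin ≠ ⊥ :=
    LinearMap.ker_ne_bot_of_finrank_lt (by simp)
  obtain ⟨c, hc, hc0⟩ := Submodule.exists_mem_ne_zero_of_ne_bot hker
  have hcx : (Function.extend x c 0) ∘ x = c := by
    funext i
    simp [x.injective.extend_apply]
  have hrange : ∀ e, e ∉ Set.range x → Function.extend x c 0 e = 0 := fun e he => by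
    rw [Function.extend_apply' _ _ _ (by simpa using he)]; rfl
  refine ⟨Function.extend x c 0, ?_, ?_, ?_⟩
  · rw [V.mulVec_eq_submatrix_mulVec x.injective hrange, hcx]
    simpa using hc
  · intro h
    apply hc0
    rw [← hcx, h]
    rfl
  · intro e he
    by_contra h
    exact he (hrange e (by rw [hx, Finset.range_orderEmbOfFin]; exact h))

/-- Every nonzero vector of the kernel has a conformal elementary vector. -/
theorem exists_conformal (hV : V.IsUniform) (hr : r ≤ n) (N : ℕ) : ∀ v : Fin n → ℝ,
    V.mulVec v = 0 → v ≠ 0 → (Finset.univ.filter fun e => v e ≠ 0).card ≤ N →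
    ∃ w : Fin n → ℝ, V.mulVec w = 0 ∧ (Finset.univ.filter fun e => w e ≠ 0).card = r + 1 ∧
      ∀ e, w e ≠ 0 → 0 < w e * v e := by
  induction N with
  | zero =>
    intro v _ hv0 hc
    rw [Nat.le_zero, Finset.card_eq_zero, Finset.filter_eq_empty_iff] at hc
    exact absurd (funext fun e => by simpa using hc (Finset.mem_univ e)) hv0
  | succ N ih =>
    intro v hv hv0 hc
    set S := Finset.univ.filter fun e => v e ≠ 0 with hS
    have hmem : ∀ e, e ∈ S ↔ v e ≠ 0 := fun e => by simp [hS]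
    have hlt : r < S.card := by
      by_contra! h
      exact hv0 (hV.eq_zero hr hv h fun e he => (hmem e).2 he)
    by_cases heq : S.card = r + 1
    · exact ⟨v, hv, heq, fun e he => mul_self_pos.2 he⟩
    obtain ⟨T, hTS, hT⟩ := Finset.exists_subset_card_eq hlt
    -- The sign of the dependency `u` is chosen so that some ratio `u e / v e` is positive; then the
    -- largest ratio `t` is positive too.
    obtain ⟨u, hu, ⟨e₀, he₀, hpos⟩, huT⟩ : ∃ u : Fin n → ℝ, V.mulVec u = 0 ∧
        (∃ e, v e ≠ 0 ∧ 0 < u e / v e) ∧ ∀ e, u e ≠ 0 → e ∈ T := by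
      obtain ⟨u, hu, hu0, huT⟩ := exists_ker_vector V hT
      obtain ⟨e, he⟩ := Function.ne_iff.1 hu0
      have hve := (hmem e).1 (hTS (huT e he))
      rcases lt_or_gt_of_ne (div_ne_zero he hve) with h | h
      · exact ⟨-u, by simp [Matrix.mulVec_neg, hu], ⟨e, hve, by simpa [neg_div] using h⟩,
          fun e he => huT e (by simpa using he)⟩
      · exact ⟨u, hu, ⟨e, hve, h⟩, huT⟩
    obtain ⟨e₁, he₁, hmax⟩ := Finset.exists_max_image S (fun e => u e / v e)
      ⟨e₀, (hmem _).2 he₀⟩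
    rw [hmem] at he₁
    set t := u e₁ / v e₁ with ht
    have htpos : 0 < t := hpos.trans_le (hmax e₀ ((hmem _).2 he₀))
    -- The vector `t • v - u` is conformal to `v` and vanishes at `e₁`.
    set v' : Fin n → ℝ := t • v - u with hv'
    have hv'e : ∀ e, v' e = t * v e - u e := fun e => rfl
    have hv'v : ∀ e, v' e ≠ 0 → v e ≠ 0 := by
      intro e he h
      apply he
      have : u e = 0 := by
        by_contra hue
        exact (hmem e).1 (hTS (huT e hue)) h
      rw [hv'e, h, this]; simp
    have hconf : ∀ e, v' e ≠ 0 → 0 < v' e * v e := by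
      intro e he
      have hve := hv'v e he
      have h1 : v' e * v e = (t - u e / v e) * (v e * v e) := by
        rw [hv'e]; field_simp
      have h2 : 0 ≤ v' e * v e := by
        rw [h1]
        exact mul_nonneg (sub_nonneg.2 (hmax e ((hmem e).2 hve))) (mul_self_nonneg _)
      exact lt_of_le_of_ne h2 (mul_ne_zero he hve).symm
    have hv'0 : v' ≠ 0 := by
      -- At an element of `S` outside `T`, `u` vanishes and `v'` equals `t * v e`, which is nonzero.
      obtain ⟨e, he, heT⟩ := Finset.exists_mem_notMem_of_card_lt_card
        (show T.card < S.card by omega)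
      intro h
      have h1 : u e = 0 := by
        by_contra hue
        exact heT (huT e hue)
      have h2 : v' e = 0 := by rw [h]; rfl
      rw [hv'e, h1, sub_zero] at h2
      exact (mul_ne_zero htpos.ne' ((hmem e).1 he)) h2
    have hcard : (Finset.univ.filter fun e => v' e ≠ 0).card < S.card := by
      apply Finset.card_lt_card
      refine ⟨fun e he => (hmem e).2 (hv'v e (by simpa using he)), fun h => ?_⟩
      have := h ((hmem e₁).2 he₁)
      rw [Finset.mem_filter] at this
      apply this.2
      rw [hv'e, ht]
      field_simp
      simp
    obtain ⟨w, hw, hwc, hwv⟩ := ih v' (by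
      rw [hv', Matrix.mulVec_sub, Matrix.mulVec_smul, hv, hu]; simp) hv'0 (by omega)
    refine ⟨w, hw, hwc, fun e he => ?_⟩
    have h1 := hwv e he
    have h2 := hconf e (right_ne_zero_of_mul h1.ne')
    have h3 : 0 < (w e * v e) * (v' e * v' e) := by nlinarith [mul_pos h1 h2]
    exact pos_of_mul_pos_left h3 (mul_self_nonneg _)

end Matrix.IsUniform

theorem card_signSupport_sign {n : ℕ} (v : Fin n → ℝ) :
    (signSupport fun e => SignType.sign (v e)).card =
      (Finset.univ.filter fun e => v e ≠ 0).card := by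
  simp [signSupport]

/-- The oriented matroid of the linear dependencies between the columns of a matrix all of whose
maximal minors are nonzero. -/
noncomputable def OrientedMatroid.ofUniformMatrix {r n : ℕ} (V : Matrix (Fin r) (Fin n) ℝ)
    (hV : V.IsUniform) (hr : r ≤ n) : OrientedMatroid (Fin n) where
  circuits := {X | ∃ v : Fin n → ℝ, V.mulVec v = 0 ∧
    (Finset.univ.filter fun e => v e ≠ 0).card = r + 1 ∧ X = fun e => SignType.sign (v e)}
  zero_notMem := by
    rintro ⟨v, -, hc, h⟩
    rw [← card_signSupport_sign, ← h] at hc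
    simp [signSupport] at hc
  neg_mem := by
    rintro _ ⟨v, hv, hc, rfl⟩
    exact ⟨-v, by simp [Matrix.mulVec_neg, hv], by simpa using hc,
      funext fun e => by simp [Left.sign_neg]⟩
  incomparable := by
    rintro _ ⟨v, hv, hc, rfl⟩ _ ⟨w, hw, hc', rfl⟩ h
    set S := Finset.univ.filter fun e => v e ≠ 0 with hS
    have hS' : (Finset.univ.filter fun e => w e ≠ 0) = S := by
      refine (Finset.eq_of_subset_of_card_le (fun e he => ?_) (by omega)).symm
      have h1 := @h e
      simp only [signSupport, Finset.mem_filter, Finset.mem_univ, true_and, sign_ne_zero] at h1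
      simp only [hS, Finset.mem_filter, Finset.mem_univ, true_and] at he ⊢
      exact h1 he
    obtain ⟨e, he⟩ : S.Nonempty := Finset.card_pos.1 (by omega)
    have hw0 : ∀ f, w f ≠ 0 ↔ f ∈ S := fun f => by rw [← hS']; simp
    have hv0 : ∀ f, v f ≠ 0 ↔ f ∈ S := fun f => by simp [hS]
    have hwe := (hw0 e).2 he
    have hve := (hv0 e).2 he
    -- This combination vanishes at `e`, so its support has at most `r` elements and uniformity
    -- kills it; the two vectors are proportional.
    have hz : w e • v - v e • w = 0 := by
      refine hV.eq_zero hr (S := S.erase e) ?_ ?_ ?_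
      · rw [Matrix.mulVec_sub, Matrix.mulVec_smul, Matrix.mulVec_smul, hv, hw]; simp
      · rw [Finset.card_erase_of_mem he]; omega
      · intro f hf
        rw [Finset.mem_erase]
        refine ⟨?_, ?_⟩
        · rintro rfl
          apply hf
          simp [mul_comm]
        · by_contra hfS
          apply hf
          have h1 : w f = 0 := by by_contra h; exact hfS ((hw0 f).1 h)
          have h2 : v f = 0 := by by_contra h; exact hfS ((hv0 f).1 h)
          simp [h1, h2]
    have hmul : ∀ f, SignType.sign (w e) * SignType.sign (v f) =
        SignType.sign (v e) * SignType.sign (w f) := by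
      intro f
      rw [← sign_mul, ← sign_mul]
      congr 1
      simpa [sub_eq_zero] using congrFun hz f
    have h1 : SignType.sign (w e) ≠ 0 := by simpa using hwe
    have h2 : SignType.sign (v e) ≠ 0 := by simpa using hve
    revert hmul h1 h2
    generalize SignType.sign (w e) = a
    generalize SignType.sign (v e) = b
    intro hmul ha hb
    by_cases hab : a = b
    · left
      funext f
      have := hmul f
      subst hab
      revert this ha
      generalize SignType.sign (v f) = c
      generalize SignType.sign (w f) = d
      cases a <;> cases c <;> cases d <;> decide
    · right
      funext f
      have := hmul f
      change SignType.sign (v f) = -SignType.sign (w f)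
      revert this ha hb hab
      generalize SignType.sign (v f) = c
      generalize SignType.sign (w f) = d
      cases a <;> cases b <;> cases c <;> cases d <;> decide
  elimination := by
    rintro _ ⟨v, hv, hc, rfl⟩ _ ⟨w, hw, hc', rfl⟩ hne e he
    simp only [signPos, signNeg, Finset.mem_inter, Finset.mem_filter, Finset.mem_univ,
      true_and, sign_eq_one_iff, sign_eq_neg_one_iff] at he
    obtain ⟨hve, hwe⟩ := he
    -- Both coefficients are positive, so each nonzero sign of `z` is a sign of `v` or of `w`, and
    -- `z` cancels at `e`. A conformal elementary vector of `z` is the circuit sought.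
    set z : Fin n → ℝ := (-w e) • v + v e • w with hz
    have hzf : ∀ f, z f = -w e * v f + v e * w f := fun f => rfl
    have hze : z e = 0 := by rw [hzf]; ring
    have hz0 : z ≠ 0 := by
      intro h0
      apply hne
      funext f
      have h1 : (-w e) * v f = v e * (-w f) := by
        have := congrFun h0 f
        rw [hzf] at this
        simp only [Pi.zero_apply] at this
        linarith
      have h2 := congrArg SignType.sign h1
      rw [sign_mul, sign_mul, sign_pos hve, sign_pos (neg_pos.2 hwe), Left.sign_neg] at h2
      simpa using h2
    obtain ⟨u, hu, huc, huz⟩ := hV.exists_conformal hr _ z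
      (by rw [hz, Matrix.mulVec_add, Matrix.mulVec_smul, Matrix.mulVec_smul, hv, hw]; simp)
      hz0 le_rfl
    refine ⟨_, ⟨u, hu, huc, rfl⟩, ?_, ?_⟩
    · intro f hf
      simp only [signPos, Finset.mem_filter, Finset.mem_univ, true_and, sign_eq_one_iff] at hf
      simp only [signPos, Finset.mem_erase, Finset.mem_union, Finset.mem_filter,
        Finset.mem_univ, true_and, sign_eq_one_iff]
      have h1 : 0 < z f := (pos_iff_pos_of_mul_pos (huz f hf.ne')).1 hf
      refine ⟨fun h => by rw [h, hze] at h1; exact lt_irrefl _ h1, ?_⟩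
      by_contra! h
      rw [hzf] at h1
      nlinarith
    · intro f hf
      simp only [signNeg, Finset.mem_filter, Finset.mem_univ, true_and,
        sign_eq_neg_one_iff] at hf
      simp only [signNeg, Finset.mem_erase, Finset.mem_union, Finset.mem_filter,
        Finset.mem_univ, true_and, sign_eq_neg_one_iff]
      have h1 : z f < 0 := (neg_iff_neg_of_mul_pos (huz f hf.ne)).1 hf
      refine ⟨fun h => by rw [h, hze] at h1; exact lt_irrefl _ h1, ?_⟩
      by_contra! h
      rw [hzf] at h1
      nlinarith

namespace OrientedMatroid

variable {r n : ℕ} {V : Matrix (Fin r) (Fin n) ℝ} (hV : V.IsUniform) (hr : r ≤ n)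

theorem ofUniformMatrix_indep_iff (S : Finset (Fin n)) :
    (ofUniformMatrix V hV hr).Indep S ↔ S.card ≤ r := by
  constructor
  · intro h
    by_contra! hc
    obtain ⟨T, hTS, hT⟩ := Finset.exists_subset_card_eq hc
    obtain ⟨v, hv, hv0, hvT⟩ := Matrix.IsUniform.exists_ker_vector V hT
    have hsub : (Finset.univ.filter fun e => v e ≠ 0) ⊆ T := fun e he =>
      hvT e (by simpa using he)
    have hle := Finset.card_le_card hsub
    have hge : r < (Finset.univ.filter fun e => v e ≠ 0).card := by
      by_contra! h
      exact hv0 (hV.eq_zero hr hv h (by simp))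
    refine h _ ⟨v, hv, by omega, rfl⟩ fun e he => hTS (hsub ?_)
    simpa [signSupport] using he
  · rintro hc _ ⟨v, -, hvc, rfl⟩ h
    have := Finset.card_le_card h
    rw [card_signSupport_sign] at this
    omega

theorem ofUniformMatrix_isBasis_iff (B : Finset (Fin n)) :
    (ofUniformMatrix V hV hr).IsBasis B ↔ B.card = r := by
  constructor
  · intro h
    have h1 := (ofUniformMatrix_indep_iff hV hr B).1 h.1
    obtain ⟨T, hT, hcard⟩ := Finset.exists_superset_card_eq h1 (by simpa using hr)
    have h2 := h.2 ((ofUniformMatrix_indep_iff hV hr T).2 hcard.le) hT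
    rw [← hcard, Finset.Subset.antisymm hT h2]
  · intro h
    refine ⟨(ofUniformMatrix_indep_iff hV hr B).2 h.le, fun T hT hBT => ?_⟩
    have h1 := (ofUniformMatrix_indep_iff hV hr T).1 hT
    exact (Finset.eq_of_subset_of_card_le hBT (by omega)).ge

theorem ofUniformMatrix_isOrderedBasis_iff (x : Fin r → Fin n) :
    (ofUniformMatrix V hV hr).IsOrderedBasis x ↔ Function.Injective x := by
  refine ⟨fun h => h.1, fun h => ⟨h, ?_⟩⟩
  rw [ofUniformMatrix_isBasis_iff, Finset.card_image_of_injective _ h]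
  simp

open Classical in
theorem ofUniformMatrix_rank : (ofUniformMatrix V hV hr).rank = r := by
  apply le_antisymm
  · refine Finset.sup_le fun S hS => ?_
    rw [Finset.mem_filter] at hS
    exact (ofUniformMatrix_indep_iff hV hr S).1 hS.2
  · obtain ⟨T, -, hT⟩ := Finset.exists_superset_card_eq
      (show (∅ : Finset (Fin n)).card ≤ r by simp) (by simpa using hr)
    have : T ∈ Finset.univ.filter fun S => (ofUniformMatrix V hV hr).Indep S := by
      rw [Finset.mem_filter]
      exact ⟨Finset.mem_univ _, (ofUniformMatrix_indep_iff hV hr T).2 hT.le⟩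
    exact hT.ge.trans (Finset.le_sup (f := Finset.card) this)

theorem ofUniformMatrix_isChirotope : (ofUniformMatrix V hV hr).IsChirotope r
    fun x => SignType.sign (V.submatrix id x).det where
  rank_eq := ofUniformMatrix_rank hV hr
  ne_zero_iff x := by
    rw [ofUniformMatrix_isOrderedBasis_iff, sign_ne_zero]
    refine ⟨fun h i j hij => ?_, hV x⟩
    by_contra hne
    exact h (Matrix.det_zero_of_column_eq hne fun l => by simp [hij])
  swap x i j hij := by
    have := (V.submatrix id x).det_permute' (Equiv.swap i j)
    rw [Equiv.Perm.sign_swap hij, Matrix.submatrix_submatrix] at this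
    have h2 : V.submatrix id (x ∘ Equiv.swap i j) =
      V.submatrix (id ∘ id) (x ∘ Equiv.swap i j) := rfl
    simp only [h2, this]
    simp [Left.sign_neg]
  pivot x i f hf hx hx' := by
    rintro _ ⟨v, hv, hc, rfl⟩ hs
    rw [ofUniformMatrix_isOrderedBasis_iff] at hx hx'
    have hsub : (Finset.univ.filter fun e => v e ≠ 0) ⊆ insert f (Finset.univ.image x) :=
      fun e he => hs (by simpa [signSupport] using he)
    have hcard : (insert f (Finset.univ.image x)).card ≤ r + 1 :=
      (Finset.card_insert_le _ _).trans
        (by rw [Finset.card_image_of_injective _ hx]; simp)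
    have heq := Finset.eq_of_subset_of_card_le hsub (by omega)
    have hmem : ∀ e, v e ≠ 0 ↔ e ∈ insert f (Finset.univ.image x) := fun e => by
      rw [← heq]; simp
    have hvf : v f ≠ 0 := (hmem f).2 (by simp)
    have hfx : ∀ l, f ≠ x l := by
      rintro l rfl
      rw [Finset.insert_eq_of_mem (by simp)] at heq
      rw [heq, Finset.card_image_of_injective _ hx] at hc
      simp at hc
    have hcol : v f • (fun l => V l f) = -((V.submatrix id x).mulVec (v ∘ x)) := by
      have hrange : ∀ e, e ∉ Set.range x → (v - (Pi.single f (v f) : Fin n → ℝ)) e = 0 := by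
        intro e he
        by_cases hef : e = f
        · subst hef; simp
        · have : v e = 0 := by
            by_contra h
            rcases Finset.mem_insert.1 ((hmem e).1 h) with h | h
            · exact hef h
            · exact he (by simpa using h)
          simp [this, hef]
      have h1 := V.mulVec_eq_submatrix_mulVec hx hrange
      have h2 : (v - (Pi.single f (v f) : Fin n → ℝ)) ∘ x = v ∘ x := by
        funext l
        simp [(hfx l).symm]
      rw [h2, Matrix.mulVec_sub, hv, Matrix.mulVec_single] at h1
      rw [← h1]
      funext l
      simp [mul_comm]
    have hdet : v f * (V.submatrix id (Function.update x i f)).det =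
        -(v (x i) * (V.submatrix id x).det) := by
      have h1 : V.submatrix id (Function.update x i f) =
          (V.submatrix id x).updateCol i fun l => V l f := by
        ext l m
        by_cases hm : m = i
        · subst hm; simp
        · simp [hm]
      -- This is Cramer's rule applied to the expression `hcol` of column `f` through the columns `x
      -- l`.
      rw [h1, ← smul_eq_mul, ← Matrix.cramer_apply, ← Pi.smul_apply, ← map_smul, hcol, map_neg,
        Matrix.cramer_eq_adjugate_mulVec, Matrix.mulVec_mulVec, Matrix.adjugate_mul]
      simp [Matrix.smul_mulVec, mul_comm]
    have h1 := congrArg SignType.sign hdet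
    rw [sign_mul, Left.sign_neg, sign_mul] at h1
    have h2 : SignType.sign (v f) ≠ 0 := sign_ne_zero.2 hvf
    revert h1 h2
    simp only
    generalize SignType.sign (v f) = a
    generalize SignType.sign (v (x i)) = b
    generalize SignType.sign (V.submatrix id (Function.update x i f)).det = c
    generalize SignType.sign (V.submatrix id x).det = d
    cases a <;> cases b <;> cases c <;> cases d <;> decide

end OrientedMatroid

/-! ### Realizing a matrix of signs by real vectors -/

/-- By the rearrangement inequality, equality would force `σ` to be increasing, hence the identity.
-/
theorem sum_perm_mul_lt_of_strictMono {r : ℕ} {g : Fin r → ℕ} (hg : StrictMono g)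
    {σ : Equiv.Perm (Fin r)} (hσ : σ ≠ 1) :
    ∑ i, (σ i : ℕ) * g i < ∑ i : Fin r, (i : ℕ) * g i := by
  have hmono : Monovary (fun i : Fin r => (i : ℕ)) g := fun i j hij =>
    (hg.lt_iff_lt.1 hij).le
  refine (hmono.sum_comp_perm_mul_lt_sum_mul_iff (σ := σ)).2 fun h => hσ ?_
  have h1 : StrictMono σ := by
    intro i j hij
    refine lt_of_le_of_ne ?_ (σ.injective.ne hij.ne)
    exact h (hg hij)
  have h2 : (σ : Fin r → Fin r) = id := (StrictMono.range_inj h1 strictMono_id).1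
    (by rw [σ.surjective.range_eq, Set.range_id])
  exact Equiv.ext fun i => congrFun h2 i

theorem sign_eq_sign_of_abs_sub_lt {a x : ℝ} (h : |x - a| < |a|) :
    SignType.sign x = SignType.sign a := by
  rw [abs_lt] at h
  rcases lt_trichotomy a 0 with ha | rfl | ha
  · rw [abs_of_neg ha] at h
    rw [sign_neg ha, sign_neg (by linarith)]
  · simp at h; linarith
  · rw [abs_of_pos ha] at h
    rw [sign_pos ha, sign_pos (by linarith)]

theorem SignType.abs_cast_eq_one {a : SignType} (h : a ≠ 0) : |(a : ℝ)| = 1 := by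
  cases a <;> simp at h ⊢

theorem SignType.sign_cast_real (a : SignType) : SignType.sign (a : ℝ) = a := by
  cases a <;> simp

/-- A real matrix whose maximal minors have the signs of the diagonal products of `A`. -/
noncomputable def lawrenceRealization {r n : ℕ} (A : Matrix (Fin r) (Fin n) SignType) :
    Matrix (Fin r) (Fin n) ℝ :=
  Matrix.of fun i j => (A i j : ℝ) * ((r.factorial : ℝ) + 1) ^ ((i : ℕ) * (j : ℕ))

/-- With `t = r! + 1`, the identity term of the Leibniz expansion has absolute value `t ^ M`. Each
of the other `r! - 1` terms is a strictly smaller power of `t`, so together they cannot change the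
sign. -/
theorem sign_det_lawrenceRealization {r n : ℕ} {A : Matrix (Fin r) (Fin n) SignType}
    (hA : ∀ i j, A i j ≠ 0) {x : Fin r → Fin n} (hx : StrictMono x) :
    SignType.sign ((lawrenceRealization A).submatrix id x).det = ∏ i, A i (x i) := by
  set t : ℝ := (r.factorial : ℝ) + 1 with ht
  have ht1 : 1 ≤ t := by rw [ht]; simp
  have htpos : 0 < t := by linarith
  set F : Equiv.Perm (Fin r) → ℝ := fun σ => ((Equiv.Perm.sign σ : ℤ) : ℝ) *
    ∏ i, (lawrenceRealization A).submatrix id x (σ i) i with hF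
  have hdet : ((lawrenceRealization A).submatrix id x).det = ∑ σ, F σ := by
    rw [Matrix.det_apply']
  have hprod : ∀ σ : Equiv.Perm (Fin r),
      ∏ i, (lawrenceRealization A).submatrix id x (σ i) i =
        (∏ i, (A (σ i) (x i) : ℝ)) * t ^ ∑ i, (σ i : ℕ) * (x i : ℕ) := by
    intro σ
    rw [← Finset.prod_pow_eq_pow_sum, ← Finset.prod_mul_distrib]
    rfl
  have habs : ∀ σ, |F σ| = t ^ ∑ i, (σ i : ℕ) * (x i : ℕ) := by
    intro σ
    have h1 : |((Equiv.Perm.sign σ : ℤ) : ℝ)| = 1 := by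
      rcases Int.units_eq_one_or (Equiv.Perm.sign σ) with h | h <;> simp [h]
    simp only [hF]
    rw [hprod, abs_mul, h1, abs_mul, Finset.abs_prod,
      Finset.prod_congr rfl fun i _ => SignType.abs_cast_eq_one (hA (σ i) (x i))]
    simp [abs_of_pos htpos]
  set M := ∑ i : Fin r, (i : ℕ) * (x i : ℕ) with hM
  have hF1 : |F 1| = t ^ M := by rw [habs]; rfl
  have hrest : |∑ σ, F σ - F 1| < |F 1| := by
    rw [← Finset.add_sum_erase _ _ (Finset.mem_univ (1 : Equiv.Perm (Fin r))), add_sub_cancel_left]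
    have hcard : (Finset.univ.erase (1 : Equiv.Perm (Fin r))).card = r.factorial - 1 := by
      rw [Finset.card_erase_of_mem (Finset.mem_univ _), Finset.card_univ, Fintype.card_perm,
        Fintype.card_fin]
    -- The exponent `M - 1` needs `M > 0`. For `M = 0` there is no other permutation, as its
    -- exponent would be below zero.
    rcases Nat.eq_zero_or_pos M with h0 | hpos
    · have : Finset.univ.erase (1 : Equiv.Perm (Fin r)) = ∅ := by
        refine Finset.eq_empty_of_forall_notMem fun σ hσ => ?_
        have := sum_perm_mul_lt_of_strictMono (g := fun i => (x i : ℕ)) (fun i j h => hx h)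
          (Finset.ne_of_mem_erase hσ)
        omega
      rw [this, hF1]
      simpa using pow_pos htpos M
    · have hle : ∀ σ ∈ Finset.univ.erase (1 : Equiv.Perm (Fin r)), |F σ| ≤ t ^ (M - 1) := by
        intro σ hσ
        rw [habs]
        have := sum_perm_mul_lt_of_strictMono (g := fun i => (x i : ℕ)) (fun i j h => hx h)
          (Finset.ne_of_mem_erase hσ)
        exact pow_le_pow_right₀ ht1 (by omega)
      calc |∑ σ ∈ Finset.univ.erase 1, F σ| ≤ ∑ σ ∈ Finset.univ.erase 1, |F σ| :=
            Finset.abs_sum_le_sum_abs _ _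
        _ ≤ (Finset.univ.erase (1 : Equiv.Perm (Fin r))).card • t ^ (M - 1) :=
            Finset.sum_le_card_nsmul _ _ _ hle
        _ < t * t ^ (M - 1) := by
            rw [nsmul_eq_mul]
            apply mul_lt_mul_of_pos_right _ (pow_pos htpos _)
            have h1 : (Finset.univ.erase (1 : Equiv.Perm (Fin r))).card ≤ r.factorial := by omega
            have h2 : ((Finset.univ.erase (1 : Equiv.Perm (Fin r))).card : ℝ) ≤ r.factorial :=
              by exact_mod_cast h1
            linarith
        _ = |F 1| := by rw [hF1, ← pow_succ']; congr 1; omega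
  rw [hdet, sign_eq_sign_of_abs_sub_lt hrest]
  simp only [hF]
  rw [hprod]
  simp only [Equiv.Perm.sign_one, Units.val_one, Int.cast_one, one_mul, Equiv.Perm.coe_one, id]
  rw [sign_mul, sign_pos (pow_pos htpos _), mul_one]
  change signHom (∏ i, (A i (x i) : ℝ)) = _
  rw [map_prod]
  exact Finset.prod_congr rfl fun i _ => SignType.sign_cast_real _

theorem isUniform_lawrenceRealization {r n : ℕ} {A : Matrix (Fin r) (Fin n) SignType}
    (hA : ∀ i j, A i j ≠ 0) : (lawrenceRealization A).IsUniform := by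
  intro x hx h0
  have hmono : StrictMono (x ∘ Tuple.sort x) :=
    (Tuple.monotone_sort x).strictMono_of_injective (hx.comp (Tuple.sort x).injective)
  have h1 := sign_det_lawrenceRealization hA hmono
  have h2 := ((lawrenceRealization A).submatrix id x).det_permute' (Tuple.sort x)
  rw [Matrix.submatrix_submatrix, h0, mul_zero] at h2
  have h3 : (lawrenceRealization A).submatrix id (x ∘ Tuple.sort x) =
    (lawrenceRealization A).submatrix (id ∘ id) (x ∘ Tuple.sort x) := rfl
  rw [h3, h2, sign_zero] at h1
  exact Finset.prod_ne_zero_iff.2 (fun i _ => hA i _) h1.symm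

theorem OrientedMatroid.exists_hasLawrenceMatrix {r n : ℕ} (hr : r ≤ n)
    {A : Matrix (Fin r) (Fin n) SignType} (hA : ∀ i j, A i j ≠ 0) :
    ∃ M : OrientedMatroid (Fin n), M.HasLawrenceMatrix A :=
  ⟨ofUniformMatrix _ (isUniform_lawrenceRealization hA) hr, hA, _,
    ofUniformMatrix_isChirotope _ hr, fun _ hx => sign_det_lawrenceRealization hA hx⟩

/-! ### Deletion and contraction of the last element -/

theorem signNeg_eq_signPos_neg {E : Type*} [Fintype E] [DecidableEq E] (X : E → SignType) :
    signNeg X = signPos fun e => -X e := by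
  ext e
  simp only [signNeg, signPos, Finset.mem_filter, Finset.mem_univ, true_and]
  cases X e <;> decide

theorem OrientedMatroid.isNeighborly_reorient_iff {E : Type*} [Fintype E] [DecidableEq E]
    (M : OrientedMatroid E) (R : Finset E) (k : ℕ) : (M.reorient R).IsNeighborly k ↔
      ∀ X ∈ M.circuits, k < (signPos (reorientSign R X)).card := by
  constructor
  · exact fun h X hX => (h _ ⟨X, hX, rfl⟩).1
  · rintro h _ ⟨X, hX, rfl⟩
    refine ⟨h X hX, ?_⟩
    rw [signNeg_eq_signPos_neg, ← reorientSign_neg]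
    exact h _ (M.neg_mem X hX)

/-- The trace of a set on all elements but the last. -/
def Finset.restrictCastSucc {n : ℕ} (R : Finset (Fin (n + 1))) : Finset (Fin n) :=
  Finset.univ.filter fun i => i.castSucc ∈ R

theorem Finset.mem_restrictCastSucc {n : ℕ} {R : Finset (Fin (n + 1))} {i : Fin n} :
    i ∈ R.restrictCastSucc ↔ i.castSucc ∈ R := by
  simp [restrictCastSucc]

theorem Finset.ext_restrictCastSucc {n : ℕ} {R R' : Finset (Fin (n + 1))}
    (h : R.restrictCastSucc = R'.restrictCastSucc)
    (hlast : Fin.last n ∈ R ↔ Fin.last n ∈ R') : R = R' := by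
  ext i
  induction i using Fin.lastCases with
  | last => exact hlast
  | cast i => rw [← mem_restrictCastSucc, h, mem_restrictCastSucc]

/-- Each trace comes from at most two sets, and the traces that come from two are counted a second
time in `S₂`. -/
theorem card_le_of_restrictCastSucc {n : ℕ} (S : Finset (Finset (Fin (n + 1))))
    (S₁ S₂ : Finset (Finset (Fin n))) (h₁ : ∀ R ∈ S, R.restrictCastSucc ∈ S₁)
    (h₂ : ∀ R ∈ S, ∀ R' ∈ S, Fin.last n ∈ R → Fin.last n ∉ R' →
      R.restrictCastSucc = R'.restrictCastSucc → R.restrictCastSucc ∈ S₂) :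
    S.card ≤ S₁.card + S₂.card := by
  set P := S.filter fun R => Fin.last n ∈ R with hP
  set Q := S.filter fun R => Fin.last n ∉ R with hQ
  have hPi : (P.image Finset.restrictCastSucc).card = P.card :=
    Finset.card_image_of_injOn fun R hR R' hR' h => Finset.ext_restrictCastSucc h
      (iff_of_true (Finset.mem_filter.1 hR).2 (Finset.mem_filter.1 hR').2)
  have hQi : (Q.image Finset.restrictCastSucc).card = Q.card :=
    Finset.card_image_of_injOn fun R hR R' hR' h => Finset.ext_restrictCastSucc h
      (iff_of_false (Finset.mem_filter.1 hR).2 (Finset.mem_filter.1 hR').2)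
  rw [← Finset.card_filter_add_card_filter_not (s := S) fun R => Fin.last n ∈ R, ← hPi, ← hQi,
    ← Finset.card_union_add_card_inter]
  apply add_le_add <;> apply Finset.card_le_card
  · intro T hT
    rcases Finset.mem_union.1 hT with hT | hT <;> obtain ⟨R, hR, rfl⟩ := Finset.mem_image.1 hT <;>
      exact h₁ R (Finset.mem_filter.1 hR).1
  · intro T hT
    obtain ⟨hT, hT'⟩ := Finset.mem_inter.1 hT
    obtain ⟨R, hR, rfl⟩ := Finset.mem_image.1 hT
    obtain ⟨R', hR', h⟩ := Finset.mem_image.1 hT'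
    rw [hP, Finset.mem_filter] at hR
    rw [hQ, Finset.mem_filter] at hR'
    exact h₂ R hR.1 R' hR'.1 hR.2 hR'.2 h.symm

theorem card_signPos_reorientSign_le {n : ℕ} (R : Finset (Fin (n + 1))) (X : Fin n → SignType)
    (Y : Fin (n + 1) → SignType) (hY : ∀ i : Fin n, Y i.castSucc = X i)
    (hlast : reorientSign R Y (Fin.last n) ≠ 1) :
    (signPos (reorientSign R Y)).card ≤
      (signPos (reorientSign R.restrictCastSucc X)).card := by
  rw [← Finset.card_map (s := signPos (reorientSign R.restrictCastSucc X)) Fin.castSuccEmb]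
  apply Finset.card_le_card
  intro e he
  simp only [signPos, Finset.mem_filter, Finset.mem_univ, true_and] at he
  induction e using Fin.lastCases with
  | last => exact absurd he hlast
  | cast i =>
    refine Finset.mem_map.2 ⟨i, ?_, rfl⟩
    simp only [signPos, Finset.mem_filter, Finset.mem_univ, true_and]
    rw [← he]
    simp only [reorientSign, Finset.mem_restrictCastSucc, hY]

theorem IsLawrenceCircuit.of_deletion {r n : ℕ} {A : Matrix (Fin r) (Fin (n + 1)) SignType}
    {X : Fin n → SignType} (h : IsLawrenceCircuit (A.submatrix id Fin.castSucc) X) :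
    IsLawrenceCircuit A (Fin.snoc X 0 : Fin (n + 1) → SignType) := by
  obtain ⟨x, hx, h1, h2⟩ := h
  refine ⟨Fin.castSucc ∘ x, (Fin.strictMono_castSucc).comp hx, fun e => ?_, fun j => ?_⟩
  · induction e using Fin.lastCases with
    | last => simp [Fin.castSucc_ne_last]
    | cast e => simp [h1]
  · simpa using h2 j

theorem IsLawrenceCircuit.of_contraction {r n : ℕ}
    {A : Matrix (Fin (r + 1)) (Fin (n + 1)) SignType} (hA : ∀ i j, A i j ≠ 0)
    {X : Fin n → SignType}
    (h : IsLawrenceCircuit (A.submatrix Fin.castSucc Fin.castSucc) X) :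
    ∃ s : SignType, s ≠ 0 ∧ IsLawrenceCircuit A (Fin.snoc X s : Fin (n + 1) → SignType) := by
  obtain ⟨x, hx, h1, h2⟩ := h
  -- The last row of `A` forces this sign at the new element.
  set s : SignType := -(X (x (Fin.last r)) * A (Fin.last r) (x (Fin.last r)).castSucc *
    A (Fin.last r) (Fin.last n)) with hs
  have hs0 : s ≠ 0 := by
    have h3 : X (x (Fin.last r)) * A (Fin.last r) (x (Fin.last r)).castSucc *
      A (Fin.last r) (Fin.last n) ≠ 0 :=
      mul_ne_zero (mul_ne_zero ((h1 _).2 ⟨_, rfl⟩) (hA _ _)) (hA _ _)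
    revert h3
    rw [hs]
    generalize X (x (Fin.last r)) * A (Fin.last r) (x (Fin.last r)).castSucc *
      A (Fin.last r) (Fin.last n) = a
    cases a <;> decide
  refine ⟨s, hs0, Fin.snoc (α := fun _ => Fin (n + 1)) (Fin.castSucc ∘ x) (Fin.last n),
    ?_, fun e => ?_, fun j => ?_⟩
  · intro a b hab
    induction b using Fin.lastCases with
    | last =>
      induction a using Fin.lastCases with
      | last => exact absurd hab (lt_irrefl _)
      | cast a => simp [Fin.castSucc_lt_last]
    | cast b =>
      induction a using Fin.lastCases with
      | last => exact absurd (hab.trans (Fin.castSucc_lt_last b)) (lt_irrefl _)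
      | cast a => simpa using hx (Fin.castSucc_lt_castSucc_iff.1 hab)
  · induction e using Fin.lastCases with
    | last =>
      refine iff_of_true (by simpa using hs0) ⟨Fin.last _, by simp⟩
    | cast e =>
      rw [Fin.snoc_castSucc, h1]
      constructor
      · rintro ⟨i, rfl⟩
        exact ⟨i.castSucc, by simp⟩
      · rintro ⟨i, hi⟩
        induction i using Fin.lastCases with
        | last => simp [(Fin.castSucc_ne_last e).symm] at hi
        | cast i => exact ⟨i, by simpa using hi⟩
  · induction j using Fin.lastCases with
    | last => simp [hs]
    | cast j =>
      rw [Fin.succ_castSucc]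
      simpa only [Fin.snoc_castSucc, Function.comp_apply, Matrix.submatrix_apply] using h2 j

open Classical in
/-- Deletion and contraction of the last element. -/
theorem OrientedMatroid.numNeighborlyReorientations_le_add {r n : ℕ}
    {A : Matrix (Fin (r + 1)) (Fin (n + 1)) SignType} {M : OrientedMatroid (Fin (n + 1))}
    {M₁ M₂ : OrientedMatroid (Fin n)} (hM : M.HasLawrenceMatrix A)
    (hM₁ : M₁.HasLawrenceMatrix (A.submatrix id Fin.castSucc))
    (hM₂ : M₂.HasLawrenceMatrix (A.submatrix Fin.castSucc Fin.castSucc)) (k : ℕ) :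
    M.numNeighborlyReorientations k ≤
      M₁.numNeighborlyReorientations k + M₂.numNeighborlyReorientations k := by
  unfold numNeighborlyReorientations
  apply card_le_of_restrictCastSucc
  · intro R hR
    simp only [Finset.mem_filter, Finset.mem_univ, true_and, isNeighborly_reorient_iff,
      hM.mem_circuits_iff, hM₁.mem_circuits_iff] at hR ⊢
    intro X hX
    refine (hR _ hX.of_deletion).trans_le (card_signPos_reorientSign_le R X _ (by simp) ?_)
    by_cases h : Fin.last n ∈ R <;> simp [reorientSign, h]
  · intro R hR R' hR' hl hl' heq
    simp only [Finset.mem_filter, Finset.mem_univ, true_and, isNeighborly_reorient_iff,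
      hM.mem_circuits_iff, hM₂.mem_circuits_iff] at hR hR' ⊢
    intro X hX
    obtain ⟨s, hs, hXs⟩ := hX.of_contraction hM.1
    -- `R` reverses the last element and `R'` does not, so one of them makes its sign in the lifted
    -- circuit negative. The more than `k` positive elements then all lie in `X`.
    by_cases h1 : s = 1
    · refine (hR _ hXs).trans_le (card_signPos_reorientSign_le R X _ (by simp) ?_)
      simp only [reorientSign, hl, if_true, Fin.snoc_last, h1]
      decide
    · rw [heq]
      refine (hR' _ hXs).trans_le (card_signPos_reorientSign_le R' X _ (by simp) ?_)
      simpa only [reorientSign, hl', if_false, Fin.snoc_last] using h1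

/-! ### Neighborly reorientations of the alternating oriented matroid -/

theorem altSum_ofFn {m : ℕ} (f : Fin m → Bool) :
    altSum (List.ofFn f) = ∑ i : Fin m, (-1) ^ (i : ℕ) * if f i then -1 else 1 := by
  induction m with
  | zero => simp [altSum]
  | succ m ih =>
    rw [List.ofFn_succ, altSum, ih, Fin.sum_univ_succ, sub_eq_add_neg, ← Finset.sum_neg_distrib]
    simp only [Fin.val_zero, pow_zero, one_mul, Fin.val_succ, pow_succ, mul_neg, mul_one, neg_mul]

theorem sum_cast_eq_card_sub {E : Type*} [Fintype E] [DecidableEq E] (X : E → SignType) :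
    ∑ e, (X e : ℤ) = (signPos X).card - (signNeg X).card := by
  have h : ∀ e, (X e : ℤ) = (if X e = 1 then 1 else 0) - if X e = -1 then 1 else 0 := by
    intro e
    cases X e <;> decide
  rw [Finset.sum_congr rfl fun e _ => h e, Finset.sum_sub_distrib, Finset.sum_boole,
    Finset.sum_boole]
  rfl

theorem card_signPos_add_card_signNeg {E : Type*} [Fintype E] [DecidableEq E]
    (X : E → SignType) : (signPos X).card + (signNeg X).card = (signSupport X).card := by
  rw [← Finset.card_union_of_disjoint]
  · congr 1
    ext e
    simp only [signPos, signNeg, signSupport, Finset.mem_union, Finset.mem_filter,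
      Finset.mem_univ, true_and]
    cases X e <;> decide
  · rw [Finset.disjoint_left]
    intro e h1 h2
    simp only [signPos, signNeg, Finset.mem_filter, Finset.mem_univ, true_and] at h1 h2
    rw [h1] at h2
    exact absurd h2 (by decide)

/-- The word of signs of a set `R` of reversed elements. -/
def signWord {n : ℕ} (R : Finset (Fin n)) : List Bool :=
  List.ofFn fun i => decide (i ∈ R)

theorem card_signPos_sub_of_chain {n m : ℕ} (R : Finset (Fin n)) {X : Fin n → SignType}
    {x : Fin m → Fin n} (hx : StrictMono x) (s : SignType)
    (hX : ∀ i, X (x i) = s * (-1) ^ (i : ℕ)) (hX' : ∀ e, X e ≠ 0 → ∃ i, x i = e) :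
    ((signPos (reorientSign R X)).card : ℤ) - (signNeg (reorientSign R X)).card =
      s * altSum (List.ofFn fun i => decide (x i ∈ R)) := by
  rw [← sum_cast_eq_card_sub, altSum_ofFn, Finset.mul_sum]
  symm
  refine Fintype.sum_of_injective x hx.injective _ _ (fun e he => ?_) fun i => ?_
  · have h0 : X e = 0 := by
      by_contra h
      exact he (hX' e h)
    by_cases h : e ∈ R <;> simp [reorientSign, h, h0]
  · have hp : ((-1 : SignType) ^ (i : ℕ) : SignType) = ((-1 : ℤ) ^ (i : ℕ)) := by
      rcases neg_one_pow_eq_or ℤ (i : ℕ) with h | h <;>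
      rcases Nat.even_or_odd (i : ℕ) with h' | h' <;> simp [h'.neg_one_pow]
    rw [← hp]
    by_cases h : x i ∈ R
    · simp only [reorientSign, h, if_true, hX, decide_true]
      cases s <;> cases (-1 : SignType) ^ (i : ℕ) <;> decide
    · simp only [reorientSign, h, if_false, hX, decide_false]
      cases s <;> cases (-1 : SignType) ^ (i : ℕ) <;> decide

theorem sublist_signWord_iff {n m : ℕ} (R : Finset (Fin n)) (t : List Bool)
    (ht : t.length = m) : t.Sublist (signWord R) ↔
      ∃ x : Fin m → Fin n, StrictMono x ∧ t = List.ofFn fun i => decide (x i ∈ R) := by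
  subst ht
  rw [List.sublist_iff_exists_fin_orderEmbedding_get_eq]
  constructor
  · rintro ⟨f, hf⟩
    refine ⟨fun i => Fin.cast (by simp [signWord]) (f i), fun i j h => f.strictMono h, ?_⟩
    conv_lhs => rw [← List.ofFn_get t]
    congr 1
    funext i
    rw [hf]
    simp only [signWord, List.get_ofFn]
  · rintro ⟨x, hx, h⟩
    refine ⟨OrderEmbedding.ofStrictMono (fun i => Fin.cast (by simp [signWord]) (x i))
      fun i j h => hx h, fun i => ?_⟩
    have h1 : t[(i : ℕ)]? = some (decide (x i ∈ R)) := by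
      exact (congrArg (·[(i : ℕ)]?) h).trans (by simp)
    rw [List.getElem?_eq_getElem i.2] at h1
    simp only [signWord, List.get_ofFn]
    exact Option.some.inj h1

/-- All subwords of length `r + 1` differ from the alternating words in more than `k` places. -/
def IsNeighborlyWord (r k : ℕ) (l : List Bool) : Prop :=
  ∀ t : List Bool, t.Sublist l → t.length = r + 1 → |altSum t| + 2 * k < r + 1

/-- With `p` positive and `q` negative elements and `p + q = r + 1`, both counts exceed `k` exactly
when `|p - q| + 2 * k < r + 1`. -/
theorem alternating_isNeighborly_iff {n : ℕ} (r k : ℕ) (R : Finset (Fin n)) :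
    ((alternatingOrientedMatroid r n).reorient R).IsNeighborly k ↔
      IsNeighborlyWord r k (signWord R) := by
  constructor
  · intro h t ht hlen
    obtain ⟨x, hx, rfl⟩ := (sublist_signWord_iff R t hlen).1 ht
    obtain ⟨Z, hc, hZ, hZx, hZe⟩ := IsAlternatingSign.of_chain x hx 1 (by decide)
    have h1 := h _ ⟨Z, ⟨hc, hZ⟩, rfl⟩
    have h2 := card_signPos_sub_of_chain R hx 1 hZx hZe
    have h3 := card_signPos_add_card_signNeg (reorientSign R Z)
    rw [signSupport_reorientSign, hc] at h3
    rw [SignType.coe_one, one_mul] at h2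
    rw [← h2, ← lt_sub_iff_add_lt, abs_lt]
    constructor <;> omega
  · rintro h _ ⟨X, ⟨hc, hX⟩, rfl⟩
    obtain ⟨x, s, hx, hs, hXx, hXe⟩ := hX.exists_chain hc
    have h1 := h _ ((sublist_signWord_iff R _ (by simp)).2 ⟨x, hx, rfl⟩) (by simp)
    have h2 := card_signPos_sub_of_chain R hx s hXx hXe
    have h3 := card_signPos_add_card_signNeg (reorientSign R X)
    rw [signSupport_reorientSign, hc] at h3
    have h4 : |(s : ℤ)| = 1 := by cases s <;> simp at hs ⊢
    rw [← one_mul |altSum _|, ← h4, ← abs_mul, ← h2, ← lt_sub_iff_add_lt, abs_lt] at h1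
    constructor <;> omega

open Classical in
theorem alternatingCount_eq (r n k : ℕ) : alternatingCount r n k =
    ((Finset.univ : Finset (Fin n → Bool)).filter
      fun f => IsNeighborlyWord r k (List.ofFn f)).card := by
  unfold alternatingCount OrientedMatroid.numNeighborlyReorientations
  refine Finset.card_bij' (fun R _ i => decide (i ∈ R)) (fun f _ => Finset.univ.filter (f ·))
    ?_ ?_ ?_ ?_
  · intro R hR
    simpa [alternating_isNeighborly_iff, signWord] using hR
  · intro f hf
    simpa [alternating_isNeighborly_iff, signWord] using hf
  · intro R hR
    ext i
    simp
  · intro f hf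
    funext i
    simp

/-- One more letter changes the alternating sum by at most one, and the allowed bound also grows by
one. -/
theorem IsNeighborlyWord.cons {r k : ℕ} {l : List Bool} (h : IsNeighborlyWord r k l) (a : Bool) :
    IsNeighborlyWord (r + 1) k (a :: l) := by
  intro t ht hlen
  match t, hlen with
  | b :: t, hlen =>
    have h1 := h t ht.of_cons_cons (by simpa using hlen)
    have h2 : |altSum (b :: t)| ≤ 1 + |altSum t| := by
      rw [altSum]
      refine (abs_sub _ _).trans ?_
      cases b <;> simp
    push_cast
    linarith

theorem isNeighborlyWord_iff_runs_le {r k : ℕ} (hr : 2 * k ≤ r) {l : List Bool}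
    (hl : 2 * r + 1 ≤ l.length + 2 * k) : IsNeighborlyWord r k l ↔ runs l + 2 * k ≤ r := by
  constructor
  · intro h
    by_contra! hc
    -- With `m = r + 1 - 2 * k`, the subword has length `r + 1` and violates the bound. The length
    -- needed is exactly `2 * (r - k) + 1`.
    obtain ⟨t, h1, h2, h3⟩ := exists_sublist_le_abs_altSum k (r + 1 - 2 * k) (by omega) l
      (by omega) (by omega)
    have := h t h1 (by omega)
    omega
  · intro h t ht _
    have h1 := abs_altSum_le_runs t
    have h2 := runs_mono ht
    omega

/-- Repeating the first letter preserves the number of blocks, hence neighborliness in rank `r + 1`.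
Prepending the opposite letter takes rank `r` to rank `r + 1`. The first two letters tell the two
images apart. -/
theorem alternatingCount_add_le {r n k : ℕ} (hr : 2 * k ≤ r + 1)
    (hn : 2 * (r + 1) + 1 ≤ n + 2 * k) :
    alternatingCount (r + 1) n k + alternatingCount r n k ≤ alternatingCount (r + 1) (n + 1) k := by
  classical
  obtain ⟨n, rfl⟩ : ∃ m, n = m + 1 := ⟨n - 1, by omega⟩
  simp only [alternatingCount_eq]
  set g₁ : (Fin (n + 1) → Bool) → Fin (n + 2) → Bool := fun f => Fin.cons (f 0) f with hg₁
  set g₂ : (Fin (n + 1) → Bool) → Fin (n + 2) → Bool := fun f => Fin.cons (!f 0) f with hg₂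
  have hi₁ : Function.Injective g₁ := fun f f' h => (Fin.cons_inj.1 h).2
  have hi₂ : Function.Injective g₂ := fun f f' h => (Fin.cons_inj.1 h).2
  rw [← Finset.card_image_of_injective _ hi₁, ← Finset.card_image_of_injective _ hi₂,
    ← Finset.card_union_of_disjoint]
  · apply Finset.card_le_card
    intro f hf
    rw [Finset.mem_filter]
    refine ⟨Finset.mem_univ _, ?_⟩
    rcases Finset.mem_union.1 hf with h | h <;> obtain ⟨f, h1, rfl⟩ := Finset.mem_image.1 h <;>
      replace h1 := (Finset.mem_filter.1 h1).2
    · clear hf h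
      rw [isNeighborlyWord_iff_runs_le hr (by simpa using hn)] at h1
      rw [isNeighborlyWord_iff_runs_le hr (by simp; omega)]
      simp only [hg₁, List.ofFn_cons]
      rw [List.ofFn_succ] at h1 ⊢
      simpa [runs] using h1
    · simp only [hg₂, List.ofFn_cons]
      exact h1.cons _
  · rw [Finset.disjoint_left]
    intro f h1 h2
    obtain ⟨f₁, -, rfl⟩ := Finset.mem_image.1 h1
    obtain ⟨f₂, -, h⟩ := Finset.mem_image.1 h2
    obtain ⟨h3, rfl⟩ := Fin.cons_inj.1 h
    simp at h3

/-! ### The induction on the number of elements -/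

-- A circuit has `r + 1 ≤ 2 * k + 1` elements, too few for `k + 1` of each sign. So the left side is
-- zero if `r < n`; otherwise `C_r(n)` has no circuits and every set is counted on the right.
open Classical in
theorem OrientedMatroid.HasLawrenceMatrix.le_alternatingCount_of_rank_le {r n k : ℕ}
    {M : OrientedMatroid (Fin n)} {A : Matrix (Fin r) (Fin n) SignType}
    (hM : M.HasLawrenceMatrix A) (hr : r ≤ 2 * k) :
    M.numNeighborlyReorientations k ≤ alternatingCount r n k := by
  unfold alternatingCount numNeighborlyReorientations
  apply Finset.card_le_card
  intro R hR
  rw [Finset.mem_filter] at hR ⊢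
  refine ⟨Finset.mem_univ _, ?_⟩
  rcases lt_or_ge r n with hrn | hrn
  · exfalso
    obtain ⟨T, -, hT⟩ := Finset.exists_superset_card_eq
      (show (∅ : Finset (Fin n)).card ≤ r + 1 by simp) (by simpa using hrn)
    obtain ⟨X, hX, rfl⟩ := hM.exists_circuit T hT
    have h1 := hR.2 _ ⟨X, hX, rfl⟩
    have h2 := card_signPos_add_card_signNeg (reorientSign R X)
    rw [signSupport_reorientSign] at h2
    omega
  · rintro _ ⟨X, ⟨hX, -⟩, rfl⟩
    have h1 := Finset.card_le_univ (signSupport X)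
    rw [hX, Fintype.card_fin] at h1
    omega

theorem mainTheorem5 (k r : ℕ)
    (h : ∀ r' n' : ℕ, 2 * k + 1 ≤ r' → r' ≤ r → (n' : ℤ) = 2 * ((r' : ℤ) - k) + 1 →
      ∀ M' : OrientedMatroid (Fin n'), M'.IsLOM r' →
        M'.numNeighborlyReorientations k ≤ alternatingCount r' n' k) :
    ∀ n : ℕ, (n : ℤ) ≥ 2 * ((r : ℤ) - k) + 1 →
      ∀ M : OrientedMatroid (Fin n), M.IsLOM r →
        M.numNeighborlyReorientations k ≤ alternatingCount r n k := by
  -- The rank varies in the induction because contraction lowers it.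
  have main : ∀ n s : ℕ, s ≤ r → (n : ℤ) ≥ 2 * ((s : ℤ) - k) + 1 →
      ∀ M : OrientedMatroid (Fin n), M.IsLOM s →
        M.numNeighborlyReorientations k ≤ alternatingCount s n k := by
    intro n
    induction n with
    | zero =>
      rintro s - hn M ⟨A, hM⟩
      exact OrientedMatroid.HasLawrenceMatrix.le_alternatingCount_of_rank_le (A := A) hM (by omega)
    | succ n ih =>
      rintro s hs hn M ⟨A, hM⟩
      by_cases hsk : s ≤ 2 * k
      · exact OrientedMatroid.HasLawrenceMatrix.le_alternatingCount_of_rank_le (A := A) hM hsk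
      by_cases heq : ((n + 1 : ℕ) : ℤ) = 2 * ((s : ℤ) - k) + 1
      · exact h s (n + 1) (by omega) hs heq M ⟨A, hM⟩
      -- The bound on `n + 1` is now strict, so both minors on `n` elements still satisfy the bound
      -- for their ranks.
      obtain ⟨s, rfl⟩ : ∃ t, s = t + 1 := ⟨s - 1, by omega⟩
      obtain ⟨M₁, hM₁⟩ := OrientedMatroid.exists_hasLawrenceMatrix (show s + 1 ≤ n by omega)
        (A := A.submatrix id Fin.castSucc) fun _ _ => hM.1 _ _
      obtain ⟨M₂, hM₂⟩ := OrientedMatroid.exists_hasLawrenceMatrix (show s ≤ n by omega)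
        (A := A.submatrix Fin.castSucc Fin.castSucc) fun _ _ => hM.1 _ _
      calc M.numNeighborlyReorientations k
          ≤ M₁.numNeighborlyReorientations k + M₂.numNeighborlyReorientations k :=
            OrientedMatroid.numNeighborlyReorientations_le_add (A := A) hM hM₁ hM₂ k
        _ ≤ alternatingCount (s + 1) n k + alternatingCount s n k :=
            add_le_add (ih (s + 1) hs (by omega) M₁ ⟨_, hM₁⟩)
              (ih s (by omega) (by omega) M₂ ⟨_, hM₂⟩)
        _ ≤ alternatingCount (s + 1) (n + 1) k :=
            alternatingCount_add_le (by omega) (by omega)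
  exact fun n hn => main n r le_rfl hn
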